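/- An operational probabilistic theory is a symmetric monoidal category whose objects are called systems (with trivial system $\mathbf 1$) and whose morphisms are called events, together with distinguished finite families of events $(t_x\colon A\to B)_{x\in X}$ called tests, and a function assigning to each event $s\colon\mathbf 1\to\mathbf 1$ a probability $\Pr(s)\ge 0$, such that: every event occurs in some test; identities and the structural isomorphisms (associators, unitors, swaps) are one-outcome tests; tests are closed under relabelling of outcomes, sequential composition, parallel composition, and merging of outcomes (the merged events having, inside every closed circuit, the sum of the probabilities of the events that were merged); the probabilities of a test $\mathbf 1\to\mathbf 1$ sum to $1$; and $\Pr(s\circ t)=\Pr(s)\Pr(t)$ for $s,t\colon\mathbf 1\to\mathbf 1$. The theory is causal (non-signalling) if every system $A$ has exactly one event $A\to\mathbf 1$ that is a one-outcome test (the discarding of $A$). A generalized Bayesian network (GBN) of shape $\mathcal G_{n,2}$ in such a theory consists of systems $A_{I,i}$ for each two-element set $I\subset\{1,\dots,n\}$ and each $i\in I$; a one-outcome preparation test $\sigma_I\colon\mathbf 1\to\bigotimes_{i\in I}A_{I,i}$ for each such $I$; and, for each $i\in\{1,\dots,n\}$, a measurement test $(M_{i,x})_{x\in X_i}$, $M_{i,x}\colon\bigotimes_{I\ni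 i}A_{I,i}\to\mathbf 1$, with finite outcome set $X_i$. It defines random variables $V_1,\dots,V_n$, $V_i\in X_i$, whose joint distribution $p(x_1,\dots,x_n)$ is the probability of the closed circuit in which all preparations $\sigma_I$ are made in parallel, each system $A_{I,i}$ is sent to the $i$-th measurement, and the events $M_{i,x_i}$ are observed in parallel. **Theorem.** Let $n\ge 0$, and let $V_1,\dots,V_n$ be the random variables defined by a GBN of shape $\mathcal G_{n,2}$ in a causal operational probabilistic theory. Then for every $i\in\{1,\dots,n\}$ $$\sum_{\substack{j\in\{1,\dots,n\}\\ j\ne i}} I(V_i:V_j)\;\le\;H(V_i),$$ where $H$ is the Shannon entropy (in bits) and $I(V:W)=H(V)+H(W)-H(V,W)$ is the mutual information. -/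

import Mathlib

open CategoryTheory MonoidalCategory

universe v u

noncomputable section

/-- An operational probabilistic theory on a symmetric monoidal category `C`.
Objects are systems, `𝟙_ C` is the trivial system, `⊗` is parallel composition, and
morphisms `A ⟶ B` are events. A test from `A` to `B` with finite outcome set `X` is a family of
events indexed by `X`. Events from the trivial system to itself (closed circuits) carry a
probability. -/
structure OperationalTheory (C : Type u) [Category.{v} C] [MonoidalCategory C]
    [SymmetricCategory C] where
  /-- Which families of events are tests. -/
  IsTest : ∀ {A B : C} {X : Type} [Fintype X], (X → (A ⟶ B)) → Prop
  /-- The probability of a closed circuit. -/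
  prob : (𝟙_ C ⟶ 𝟙_ C) → ℝ
  /-- Every event occurs in some test. -/
  event_mem : ∀ {A B : C} (f : A ⟶ B), ∃ (X : Type) (_ : Fintype X) (t : X → (A ⟶ B)),
    IsTest t ∧ ∃ x, t x = f
  /-- The names of the outcomes are irrelevant. -/
  relabel : ∀ {A B : C} {X Y : Type} [Fintype X] [Fintype Y] (e : Y ≃ X) (t : X → (A ⟶ B)),
    IsTest t → IsTest (fun y => t (e y))
  /-- Doing nothing, regrouping systems and swapping systems are deterministic tests. -/
  test_id : ∀ A : C, IsTest (fun _ : Unit => 𝟙 A)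
  test_associator_hom : ∀ A B D : C, IsTest (fun _ : Unit => (α_ A B D).hom)
  test_associator_inv : ∀ A B D : C, IsTest (fun _ : Unit => (α_ A B D).inv)
  test_leftUnitor_hom : ∀ A : C, IsTest (fun _ : Unit => (λ_ A).hom)
  test_leftUnitor_inv : ∀ A : C, IsTest (fun _ : Unit => (λ_ A).inv)
  test_rightUnitor_hom : ∀ A : C, IsTest (fun _ : Unit => (ρ_ A).hom)
  test_rightUnitor_inv : ∀ A : C, IsTest (fun _ : Unit => (ρ_ A).inv)
  test_braiding : ∀ A B : C, IsTest (fun _ : Unit => (β_ A B).hom)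
  /-- Sequential composition of tests. -/
  test_comp : ∀ {A B D : C} {X Y : Type} [Fintype X] [Fintype Y]
    (s : X → (A ⟶ B)) (t : Y → (B ⟶ D)),
    IsTest s → IsTest t → IsTest (fun z : X × Y => s z.1 ≫ t z.2)
  /-- Parallel composition of tests. -/
  test_tensor : ∀ {A B D E : C} {X Y : Type} [Fintype X] [Fintype Y]
    (s : X → (A ⟶ B)) (t : Y → (D ⟶ E)),
    IsTest s → IsTest t → IsTest (fun z : X × Y => s z.1 ⊗ₘ t z.2)
  /-- A closed test is a probability distribution on its outcomes. -/
  prob_nonneg : ∀ s : 𝟙_ C ⟶ 𝟙_ C, 0 ≤ prob s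
  prob_sum : ∀ {X : Type} [Fintype X] (t : X → (𝟙_ C ⟶ 𝟙_ C)), IsTest t → ∑ x, prob (t x) = 1
  /-- Independent closed circuits have independent outcomes. -/
  prob_comp : ∀ s t : 𝟙_ C ⟶ 𝟙_ C, prob (s ≫ t) = prob s * prob t
  /-- Coarse-graining: outcomes of a test may be merged along a surjection `φ`, giving a test
  whose events have, inside every closed circuit, the sum of the probabilities of the
  merged events. -/
  coarseGrain : ∀ {A B : C} {X Y : Type} [Fintype X] [Fintype Y] [DecidableEq Y] (φ : X → Y)
    (t : X → (A ⟶ B)), Function.Surjective φ → IsTest t →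
    ∃ s : Y → (A ⟶ B), IsTest s ∧
      ∀ (y : Y) (R : C) (ψ : 𝟙_ C ⟶ A ⊗ R) (a : B ⊗ R ⟶ 𝟙_ C),
        prob (ψ ≫ s y ▷ R ≫ a) =
          ∑ x ∈ Finset.univ.filter (fun x => φ x = y), prob (ψ ≫ t x ▷ R ≫ a)

/-- The theory is causal (non-signalling): every system can be discarded in exactly one way, that
is, has exactly one deterministic effect. -/
def OperationalTheory.IsCausal {C : Type u} [Category.{v} C] [MonoidalCategory C]
    [SymmetricCategory C] (T : OperationalTheory C) : Prop :=
  ∀ A : C, ∃! d : A ⟶ 𝟙_ C, T.IsTest (fun _ : Unit => d)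

section Circuits

variable {C : Type u} [Category.{v} C] [MonoidalCategory C]

/-- The composite of the systems `A x`, for `x` in the list `l`. -/
def tensorList {ι : Type} : List ι → (ι → C) → C
  | [], _ => 𝟙_ C
  | x :: l, A => A x ⊗ tensorList l A

/-- Preparations made in parallel. -/
def parallelStates {ι : Type} {A : ι → C} (s : ∀ x, 𝟙_ C ⟶ A x) :
    (l : List ι) → (𝟙_ C ⟶ tensorList l A)
  | [] => 𝟙 (𝟙_ C)
  | x :: l => (λ_ (𝟙_ C)).inv ≫ (s x ⊗ₘ parallelStates s l)

/-- Measurement events observed in parallel. -/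
def parallelEffects {ι : Type} {A : ι → C} (a : ∀ x, A x ⟶ 𝟙_ C) :
    (l : List ι) → (tensorList l A ⟶ 𝟙_ C)
  | [] => 𝟙 (𝟙_ C)
  | x :: l => (a x ⊗ₘ parallelEffects a l) ≫ (λ_ (𝟙_ C)).hom

/-- The trivial system regarded as a composite of trivial systems. -/
def splitUnit {ι : Type} : (l : List ι) → (𝟙_ C ⟶ tensorList l (fun _ => 𝟙_ C))
  | [] => 𝟙 (𝟙_ C)
  | _ :: l => (λ_ (𝟙_ C)).inv ≫ (𝟙_ C ◁ splitUnit l)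

/-- The rearrangement `(⨂ A x) ⊗ (⨂ B x) ⟶ ⨂ (A x ⊗ B x)`. -/
def zipTensor [SymmetricCategory C] {ι : Type} (A B : ι → C) :
    (l : List ι) → (tensorList l A ⊗ tensorList l B ⟶ tensorList l (fun x => A x ⊗ B x))
  | [] => (λ_ (𝟙_ C)).hom
  | x :: l => tensorμ (A x) (tensorList l A) (B x) (tensorList l B) ≫
      ((A x ⊗ B x) ◁ zipTensor A B l)

/-- The wiring `⨂ₑ ⨂ᵢ A e i ⟶ ⨂ᵢ ⨂ₑ A e i`: the wires `A e i`, grouped by the node `e` they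
come out of, are regrouped by the node `i` that they enter. -/
def wiring [SymmetricCategory C] {ε ι : Type} (A : ε → ι → C) (k : List ι) :
    (l : List ε) → (tensorList l (fun e => tensorList k (A e)) ⟶
      tensorList k (fun i => tensorList l (fun e => A e i)))
  | [] => splitUnit k
  | e :: l => (tensorList k (A e) ◁ wiring A k l) ≫
      zipTensor (A e) (fun i => tensorList l (fun e => A e i)) k

end Circuits

/-- The preparation nodes of the graph `𝒢_{n,m}`: one for each set of `m` of the `n` parties. -/
abbrev SourceNode (n m : ℕ) : Type := {I : Finset (Fin n) // I.card = m}

/-- The system sent along the graph `𝒢_{n,m}` from the source `I` to the party `i`: the label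
`A I i` of the edge if `i ∈ I`, and the trivial system if there is no edge. -/
def edgeSystem {C : Type u} [Category.{v} C] [MonoidalCategory C] {n m : ℕ}
    (A : SourceNode n m → Fin n → C) (I : SourceNode n m) (i : Fin n) : C :=
  if i ∈ I.1 then A I i else 𝟙_ C

/-- A generalized Bayesian network of shape `𝒢_{n,m}` in the theory `T`, where the `i`-th party
has outcomes in `X i`: a deterministic preparation on the outgoing edges of each source,
and a measurement test on the incoming edges of each party. -/
structure GBN {C : Type u} [Category.{v} C] [MonoidalCategory C] [SymmetricCategory C]
    (T : OperationalTheory C) (n m : ℕ) (X : Fin n → Type) [∀ i, Fintype (X i)] where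
  /-- The labels of the edges; only the values with `i ∈ I` are used. -/
  edge : SourceNode n m → Fin n → C
  /-- The preparations. -/
  source : ∀ I, 𝟙_ C ⟶ tensorList (List.finRange n) (edgeSystem edge I)
  source_isTest : ∀ I, T.IsTest (fun _ : Unit => source I)
  /-- The measurements. -/
  meas : ∀ i, X i →
    (tensorList (Finset.univ : Finset (SourceNode n m)).toList
      (fun I => edgeSystem edge I i) ⟶ 𝟙_ C)
  meas_isTest : ∀ i, T.IsTest (meas i)

/-- The joint distribution of the outcomes: the probability of the closed circuit in which all
sources are prepared, the wires are routed to the parties, and party `i` observes `x i`. -/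
def GBN.dist {C : Type u} [Category.{v} C] [MonoidalCategory C] [SymmetricCategory C]
    {T : OperationalTheory C} {n m : ℕ} {X : Fin n → Type} [∀ i, Fintype (X i)]
    (N : GBN T n m X) (x : ∀ i, X i) : ℝ :=
  T.prob (parallelStates N.source (Finset.univ : Finset (SourceNode n m)).toList ≫
    wiring (edgeSystem N.edge) (List.finRange n)
      (Finset.univ : Finset (SourceNode n m)).toList ≫
    parallelEffects (fun i => N.meas i (x i)) (List.finRange n))

section Entropy

variable {Ω : Type} [Fintype Ω]

open Classical in
/-- The distribution of the random variable `V` when the finite sample space `Ω` carries the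
probability weights `p`. -/
def lawOf (p : Ω → ℝ) {Y : Type} (V : Ω → Y) (y : Y) : ℝ :=
  ∑ ω ∈ Finset.univ.filter (fun ω => V ω = y), p ω

/-- Shannon entropy `H(V)`, in bits. -/
def shannonEntropy (p : Ω → ℝ) {Y : Type} [Fintype Y] (V : Ω → Y) : ℝ :=
  -∑ y, lawOf p V y * Real.logb 2 (lawOf p V y)

/-- Mutual information `I(V : W) = H(V) + H(W) - H(V, W)`. -/
def mutualInfo (p : Ω → ℝ) {Y Z : Type} [Fintype Y] [Fintype Z] (V : Ω → Y) (W : Ω → Z) : ℝ :=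
  shannonEntropy p V + shannonEntropy p W - shannonEntropy p (fun ω => (V ω, W ω))

end Entropy

end

/-! The proof compares the network with a star around party `i`. There `i` receives its usual
systems, and every other party `j` shares with `i` the source `{i, j}` but gets fresh private
preparations of the marginals of its remaining sources. Nothing is cloned: a preparation is merely
repeated.

In a causal theory discarding is unique, hence signalling is impossible. If all parties except `i`
and `j` are discarded, every source other than `{i, j}` has at most one recipient left and can be
replaced by its marginals. So star and network give `(V_i, V_j)` the same law (`circuit_of_pair`,
`star_eq_circuit`). If `i` is discarded, the star falls apart into closed circuits, one per source,
so the other parties are independent (`star_independent`).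

What remains is classical (`sum_mutualInfo_le_of_le_prod`). Let `q` be the joint law of the star and
`r` the law with the same pairs `(V_i, V_j)` in which the `V_j` are independent given `V_i`. Then `∑
I(V_i : V_j) - H(V_i)` is the `q`-expectation of the logarithm of `r / ∏ q_j`, with `q_j` the law of
`V_j`. Since `log t ≤ t - 1` and `q ≤ ∏ q_j` by independence, it is at most a positive multiple of
`∑ r - ∑ q ≤ 0`.

The star is not built as a network. It is the number `GBN.star`, defined by feeding to `i` the
states left by the effects on the other wires of its sources. -/

/-! ### Singling out one factor of a parallel composite -/

section Tensor

variable {C : Type u} [Category.{v} C] [MonoidalCategory C]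

/-- Events applied in parallel. -/
def parallelMaps {ι : Type} {A B : ι → C} (f : ∀ x, A x ⟶ B x) :
    (l : List ι) → (tensorList l A ⟶ tensorList l B)
  | [] => 𝟙 (𝟙_ C)
  | x :: l => f x ⊗ₘ parallelMaps f l

/-- The effects `c x` are applied to all factors but the `i`-th. -/
def keepFactor {ι : Type} [DecidableEq ι] {A : ι → C} (i : ι) (c : ∀ x, A x ⟶ 𝟙_ C) :
    (l : List ι) → i ∈ l → (tensorList l A ⟶ A i)
  | x :: l, h =>
    if hx : x = i then (A x ◁ parallelEffects c l) ≫ (ρ_ (A x)).hom ≫ eqToHom (congrArg A hx)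
    else (c x ⊗ₘ keepFactor i c l (List.mem_of_ne_of_mem (Ne.symm hx) h)) ≫ (λ_ (A i)).hom

/-- All factors but the `i`-th are prepared in the states `s x`. -/
def insertFactor {ι : Type} [DecidableEq ι] {A : ι → C} (i : ι) (s : ∀ x, 𝟙_ C ⟶ A x) :
    (l : List ι) → i ∈ l → (A i ⟶ tensorList l A)
  | x :: l, h =>
    if hx : x = i then
      eqToHom (congrArg A hx.symm) ≫ (ρ_ (A x)).inv ≫ (A x ◁ parallelStates s l)
    else (λ_ (A i)).inv ≫ (s x ⊗ₘ insertFactor i s l (List.mem_of_ne_of_mem (Ne.symm hx) h))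

section Factors

variable {ι : Type} [DecidableEq ι] {A : ι → C}

lemma keepFactor_cons_self (i : ι) (c : ∀ x, A x ⟶ 𝟙_ C) (l : List ι) (h : i ∈ i :: l) :
    keepFactor i c (i :: l) h = (A i ◁ parallelEffects c l) ≫ (ρ_ (A i)).hom := by
  simp [keepFactor]
  rfl

lemma keepFactor_cons_of_ne {i x : ι} (hx : x ≠ i) (c : ∀ x, A x ⟶ 𝟙_ C) (l : List ι)
    (h : i ∈ x :: l) (h' : i ∈ l) :
    keepFactor i c (x :: l) h = (c x ⊗ₘ keepFactor i c l h') ≫ (λ_ (A i)).hom := by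
  simp [keepFactor, hx]
  rfl

lemma insertFactor_cons_self (i : ι) (s : ∀ x, 𝟙_ C ⟶ A x) (l : List ι) (h : i ∈ i :: l) :
    insertFactor i s (i :: l) h = (ρ_ (A i)).inv ≫ (A i ◁ parallelStates s l) := by
  simp [insertFactor]
  rfl

lemma insertFactor_cons_of_ne {i x : ι} (hx : x ≠ i) (s : ∀ x, 𝟙_ C ⟶ A x) (l : List ι)
    (h : i ∈ x :: l) (h' : i ∈ l) :
    insertFactor i s (x :: l) h = (λ_ (A i)).inv ≫ (s x ⊗ₘ insertFactor i s l h') := by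
  simp [insertFactor, hx]
  rfl

omit [DecidableEq ι] in
lemma parallelEffects_congr {c c' : ∀ x, A x ⟶ 𝟙_ C} {l : List ι} (h : ∀ x ∈ l, c x = c' x) :
    parallelEffects c l = parallelEffects c' l := by
  induction l with
  | nil => rfl
  | cons x l ih =>
    simp only [parallelEffects]
    rw [h x (by simp), ih fun y hy => h y (by simp [hy])]

omit [DecidableEq ι] in
lemma parallelStates_congr {s s' : ∀ x, 𝟙_ C ⟶ A x} {l : List ι} (h : ∀ x ∈ l, s x = s' x) :
    parallelStates s l = parallelStates s' l := by
  induction l with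
  | nil => rfl
  | cons x l ih =>
    simp only [parallelStates]
    rw [h x (by simp), ih fun y hy => h y (by simp [hy])]

/-- As `i` occurs only once in `l`, the effect `c i` is never applied. -/
lemma keepFactor_congr {i : ι} {c c' : ∀ x, A x ⟶ 𝟙_ C} {l : List ι} (hl : l.Nodup)
    (hi : i ∈ l) (h : ∀ x, x ≠ i → c x = c' x) :
    keepFactor i c l hi = keepFactor i c' l hi := by
  induction l with
  | nil => simp at hi
  | cons x l ih =>
    rw [List.nodup_cons] at hl
    by_cases hx : x = i
    · subst hx
      rw [keepFactor_cons_self, keepFactor_cons_self,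
        parallelEffects_congr fun y hy => h y (by rintro rfl; exact hl.1 hy)]
    · have h' : i ∈ l := List.mem_of_ne_of_mem (Ne.symm hx) hi
      rw [keepFactor_cons_of_ne hx _ _ _ h', keepFactor_cons_of_ne hx _ _ _ h', ih hl.2 h', h x hx]

lemma insertFactor_congr {i : ι} {s s' : ∀ x, 𝟙_ C ⟶ A x} {l : List ι} (hl : l.Nodup)
    (hi : i ∈ l) (h : ∀ x, x ≠ i → s x = s' x) :
    insertFactor i s l hi = insertFactor i s' l hi := by
  induction l with
  | nil => simp at hi
  | cons x l ih =>
    rw [List.nodup_cons] at hl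
    by_cases hx : x = i
    · subst hx
      rw [insertFactor_cons_self, insertFactor_cons_self,
        parallelStates_congr fun y hy => h y (by rintro rfl; exact hl.1 hy)]
    · have h' : i ∈ l := List.mem_of_ne_of_mem (Ne.symm hx) hi
      rw [insertFactor_cons_of_ne hx _ _ _ h', insertFactor_cons_of_ne hx _ _ _ h', ih hl.2 h',
        h x hx]

/-- Isolates one effect, so that a circuit takes the form `ψ ≫ c i` required by `sum_prob`. -/
lemma keepFactor_comp {i : ι} (c : ∀ x, A x ⟶ 𝟙_ C) {l : List ι} (hi : i ∈ l) :
    keepFactor i c l hi ≫ c i = parallelEffects c l := by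
  induction l with
  | nil => simp at hi
  | cons x l ih =>
    by_cases hx : x = i
    · subst hx
      rw [keepFactor_cons_self]
      change ((A x ◁ parallelEffects c l) ≫ (ρ_ (A x)).hom) ≫ c x =
        (c x ⊗ₘ parallelEffects c l) ≫ (λ_ (𝟙_ C)).hom
      rw [tensorHom_def']
      simp [unitors_equal]
    · have h' : i ∈ l := List.mem_of_ne_of_mem (Ne.symm hx) hi
      rw [keepFactor_cons_of_ne hx _ _ _ h']
      change ((c x ⊗ₘ keepFactor i c l h') ≫ (λ_ (A i)).hom) ≫ c i =
        (c x ⊗ₘ parallelEffects c l) ≫ (λ_ (𝟙_ C)).hom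
      rw [← ih h', MonoidalCategory.tensorHom_def, MonoidalCategory.tensorHom_def]
      simp

lemma comp_insertFactor {i : ι} (s : ∀ x, 𝟙_ C ⟶ A x) {l : List ι} (hi : i ∈ l) :
    s i ≫ insertFactor i s l hi = parallelStates s l := by
  induction l with
  | nil => simp at hi
  | cons x l ih =>
    by_cases hx : x = i
    · subst hx
      rw [insertFactor_cons_self]
      change s x ≫ (ρ_ (A x)).inv ≫ (A x ◁ parallelStates s l) =
        (λ_ (𝟙_ C)).inv ≫ (s x ⊗ₘ parallelStates s l)
      rw [MonoidalCategory.tensorHom_def, unitors_inv_equal]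
      simp
    · have h' : i ∈ l := List.mem_of_ne_of_mem (Ne.symm hx) hi
      rw [insertFactor_cons_of_ne hx _ _ _ h']
      change s i ≫ (λ_ (A i)).inv ≫ (s x ⊗ₘ insertFactor i s l h') =
        (λ_ (𝟙_ C)).inv ≫ (s x ⊗ₘ parallelStates s l)
      rw [← ih h', tensorHom_def', tensorHom_def']
      simp

end Factors

/-! ### Parallel maps and scalars -/

section Maps

variable {ι : Type} {A B D : ι → C}

lemma parallelMaps_comp (f : ∀ x, A x ⟶ B x) (g : ∀ x, B x ⟶ D x) (l : List ι) :
    parallelMaps f l ≫ parallelMaps g l = parallelMaps (fun x => f x ≫ g x) l := by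
  induction l with
  | nil => exact Category.id_comp (𝟙 (𝟙_ C))
  | cons x l ih =>
    change (f x ⊗ₘ parallelMaps f l) ≫ (g x ⊗ₘ parallelMaps g l) = (f x ≫ g x) ⊗ₘ parallelMaps _ l
    rw [tensorHom_comp_tensorHom, ih]

lemma parallelStates_comp_parallelMaps (s : ∀ x, 𝟙_ C ⟶ A x) (f : ∀ x, A x ⟶ B x) (l : List ι) :
    parallelStates s l ≫ parallelMaps f l = parallelStates (fun x => s x ≫ f x) l := by
  induction l with
  | nil => exact Category.id_comp (𝟙 (𝟙_ C))
  | cons x l ih =>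
    change ((λ_ (𝟙_ C)).inv ≫ (s x ⊗ₘ parallelStates s l)) ≫ (f x ⊗ₘ parallelMaps f l) =
      (λ_ (𝟙_ C)).inv ≫ ((s x ≫ f x) ⊗ₘ parallelStates _ l)
    rw [Category.assoc, tensorHom_comp_tensorHom, ih]

lemma parallelMaps_comp_parallelEffects (f : ∀ x, A x ⟶ B x) (a : ∀ x, B x ⟶ 𝟙_ C)
    (l : List ι) :
    parallelMaps f l ≫ parallelEffects a l = parallelEffects (fun x => f x ≫ a x) l := by
  induction l with
  | nil => exact Category.id_comp (𝟙 (𝟙_ C))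
  | cons x l ih =>
    change (f x ⊗ₘ parallelMaps f l) ≫ (a x ⊗ₘ parallelEffects a l) ≫ (λ_ (𝟙_ C)).hom =
      ((f x ≫ a x) ⊗ₘ parallelEffects _ l) ≫ (λ_ (𝟙_ C)).hom
    rw [tensorHom_comp_tensorHom_assoc, ih]

lemma splitUnit_comp_parallelMaps (s : ∀ x, 𝟙_ C ⟶ A x) (l : List ι) :
    splitUnit l ≫ parallelMaps s l = parallelStates s l := by
  induction l with
  | nil => exact Category.id_comp (𝟙 (𝟙_ C))
  | cons x l ih =>
    change ((λ_ (𝟙_ C)).inv ≫ (𝟙_ C ◁ splitUnit l)) ≫ (s x ⊗ₘ parallelMaps s l) =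
      (λ_ (𝟙_ C)).inv ≫ (s x ⊗ₘ parallelStates s l)
    rw [Category.assoc, ← id_tensorHom, tensorHom_comp_tensorHom, ih, Category.id_comp]

end Maps

/-- The Eckmann–Hilton identity: it lets `prob_comp` be applied to circuits run in parallel. -/
lemma scalar_tensor (s t : 𝟙_ C ⟶ 𝟙_ C) :
    (λ_ (𝟙_ C)).inv ≫ (s ⊗ₘ t) ≫ (λ_ (𝟙_ C)).hom = s ≫ t := by
  rw [MonoidalCategory.tensorHom_def, Category.assoc, leftUnitor_naturality, unitors_inv_equal,
    unitors_equal, rightUnitor_naturality_assoc, Iso.inv_hom_id_assoc]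

/-! ### Routing of product states -/

section Zip

variable [SymmetricCategory C]

lemma leftUnitor_inv_comp_tensorμ (X Y : C) :
    (λ_ (𝟙_ C)).inv ▷ (X ⊗ Y) ≫ tensorμ (𝟙_ C) (𝟙_ C) X Y =
      (λ_ (X ⊗ Y)).hom ≫ ((λ_ X).inv ⊗ₘ (λ_ Y).inv) := by
  rw [tensor_left_unitality]
  simp

lemma rightUnitor_inv_comp_tensorμ (X Y : C) :
    (X ⊗ Y) ◁ (λ_ (𝟙_ C)).inv ≫ tensorμ X Y (𝟙_ C) (𝟙_ C) =
      (ρ_ (X ⊗ Y)).hom ≫ ((ρ_ X).inv ⊗ₘ (ρ_ Y).inv) := by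
  rw [tensor_right_unitality]
  simp

variable {ι : Type}

lemma zipTensor_natural {A B A' B' : ι → C} (f : ∀ x, A x ⟶ A' x) (g : ∀ x, B x ⟶ B' x)
    (l : List ι) :
    (parallelMaps f l ⊗ₘ parallelMaps g l) ≫ zipTensor A' B' l =
      zipTensor A B l ≫ parallelMaps (fun x => f x ⊗ₘ g x) l := by
  induction l with
  | nil =>
    change (𝟙 (𝟙_ C) ⊗ₘ 𝟙 (𝟙_ C)) ≫ (λ_ (𝟙_ C)).hom = (λ_ (𝟙_ C)).hom ≫ 𝟙 (𝟙_ C)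
    simp
  | cons x l ih =>
    change ((f x ⊗ₘ parallelMaps f l) ⊗ₘ (g x ⊗ₘ parallelMaps g l)) ≫
        tensorμ (A' x) (tensorList l A') (B' x) (tensorList l B') ≫
          ((A' x ⊗ B' x) ◁ zipTensor A' B' l) =
      (tensorμ (A x) (tensorList l A) (B x) (tensorList l B) ≫
        ((A x ⊗ B x) ◁ zipTensor A B l)) ≫
          ((f x ⊗ₘ g x) ⊗ₘ parallelMaps (fun x => f x ⊗ₘ g x) l)
    rw [← Category.assoc, tensorμ_natural, Category.assoc, Category.assoc, ← id_tensorHom,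
      ← id_tensorHom, tensorHom_comp_tensorHom, tensorHom_comp_tensorHom, ih]
    simp

/-- Trivial wires are a unit for zipping. A product state is a local image of `splitUnit`, so by
naturality zipping with it becomes a local operation. -/
lemma splitUnit_zipTensor (B : ι → C) (l : List ι) :
    (splitUnit l ▷ tensorList l B) ≫ zipTensor (fun _ => 𝟙_ C) B l =
      (λ_ (tensorList l B)).hom ≫ parallelMaps (fun x => (λ_ (B x)).inv) l := by
  induction l with
  | nil =>
    change (𝟙 (𝟙_ C) ▷ 𝟙_ C) ≫ (λ_ (𝟙_ C)).hom = (λ_ (𝟙_ C)).hom ≫ 𝟙 (𝟙_ C)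
    simp
  | cons x l ih =>
    have h : (𝟙_ C ◁ splitUnit l) ▷ (B x ⊗ tensorList l B) ≫
        tensorμ (𝟙_ C) (tensorList l fun _ => 𝟙_ C) (B x) (tensorList l B) =
        tensorμ (𝟙_ C) (𝟙_ C) (B x) (tensorList l B) ≫
          ((𝟙_ C ⊗ B x) ◁ (splitUnit l ▷ tensorList l B)) := by
      have := tensorμ_natural_left (𝟙 (𝟙_ C)) (splitUnit (C := C) l) (B x) (tensorList l B)
      simpa using this
    change (((λ_ (𝟙_ C)).inv ≫ (𝟙_ C ◁ splitUnit l)) ▷ (B x ⊗ tensorList l B)) ≫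
      tensorμ (𝟙_ C) (tensorList l fun _ => 𝟙_ C) (B x) (tensorList l B) ≫
        ((𝟙_ C ⊗ B x) ◁ zipTensor (fun _ => 𝟙_ C) B l) =
      (λ_ (B x ⊗ tensorList l B)).hom ≫
        ((λ_ (B x)).inv ⊗ₘ parallelMaps (fun x => (λ_ (B x)).inv) l)
    rw [comp_whiskerRight, Category.assoc, reassoc_of% h, ← whiskerLeft_comp, ih,
      reassoc_of% leftUnitor_inv_comp_tensorμ, ← id_tensorHom, tensorHom_comp_tensorHom]
    simp

lemma zipTensor_splitUnit (B : ι → C) (l : List ι) :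
    (tensorList l B ◁ splitUnit l) ≫ zipTensor B (fun _ => 𝟙_ C) l =
      (ρ_ (tensorList l B)).hom ≫ parallelMaps (fun x => (ρ_ (B x)).inv) l := by
  induction l with
  | nil =>
    change (𝟙_ C ◁ 𝟙 (𝟙_ C)) ≫ (λ_ (𝟙_ C)).hom = (ρ_ (𝟙_ C)).hom ≫ 𝟙 (𝟙_ C)
    simp [unitors_equal]
  | cons x l ih =>
    have h : (B x ⊗ tensorList l B) ◁ (𝟙_ C ◁ splitUnit l) ≫
        tensorμ (B x) (tensorList l B) (𝟙_ C) (tensorList l fun _ => 𝟙_ C) =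
        tensorμ (B x) (tensorList l B) (𝟙_ C) (𝟙_ C) ≫
          ((B x ⊗ 𝟙_ C) ◁ (tensorList l B ◁ splitUnit l)) := by
      have := tensorμ_natural_right (B x) (tensorList l B) (𝟙 (𝟙_ C)) (splitUnit (C := C) l)
      simpa using this
    change ((B x ⊗ tensorList l B) ◁ ((λ_ (𝟙_ C)).inv ≫ (𝟙_ C ◁ splitUnit l))) ≫
      tensorμ (B x) (tensorList l B) (𝟙_ C) (tensorList l fun _ => 𝟙_ C) ≫
        ((B x ⊗ 𝟙_ C) ◁ zipTensor B (fun _ => 𝟙_ C) l) =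
      (ρ_ (B x ⊗ tensorList l B)).hom ≫
        ((ρ_ (B x)).inv ⊗ₘ parallelMaps (fun x => (ρ_ (B x)).inv) l)
    rw [whiskerLeft_comp, Category.assoc, reassoc_of% h, ← whiskerLeft_comp, ih,
      reassoc_of% rightUnitor_inv_comp_tensorμ, ← id_tensorHom, tensorHom_comp_tensorHom]
    simp

/-- Zipping a product state with an arbitrary local image of a joint state. -/
lemma zip_states_left {ι : Type} {A B D : ι → C} (α : ∀ x, 𝟙_ C ⟶ A x) (f : ∀ x, B x ⟶ D x)
    (l : List ι) (ω : 𝟙_ C ⟶ tensorList l B) :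
    (λ_ (𝟙_ C)).inv ≫ (parallelStates α l ⊗ₘ (ω ≫ parallelMaps f l)) ≫ zipTensor A D l =
      ω ≫ parallelMaps (fun x => (λ_ (B x)).inv ≫ (α x ⊗ₘ f x)) l := by
  rw [← splitUnit_comp_parallelMaps, ← tensorHom_comp_tensorHom, Category.assoc,
    zipTensor_natural, tensorHom_def', Category.assoc]
  have := splitUnit_zipTensor B l
  rw [reassoc_of% this, parallelMaps_comp]
  simp

lemma zip_states_right {ι : Type} {A B D : ι → C} (α : ∀ x, 𝟙_ C ⟶ A x) (f : ∀ x, B x ⟶ D x)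
    (l : List ι) (ω : 𝟙_ C ⟶ tensorList l B) :
    (λ_ (𝟙_ C)).inv ≫ ((ω ≫ parallelMaps f l) ⊗ₘ parallelStates α l) ≫ zipTensor D A l =
      ω ≫ parallelMaps (fun x => (ρ_ (B x)).inv ≫ (f x ⊗ₘ α x)) l := by
  rw [← splitUnit_comp_parallelMaps, ← tensorHom_comp_tensorHom, Category.assoc,
    zipTensor_natural, MonoidalCategory.tensorHom_def, Category.assoc]
  have := zipTensor_splitUnit B l
  rw [reassoc_of% this, parallelMaps_comp, unitors_inv_equal]
  simp

lemma zip_states {ι : Type} {A B : ι → C} (α : ∀ x, 𝟙_ C ⟶ A x) (β : ∀ x, 𝟙_ C ⟶ B x)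
    (l : List ι) :
    (λ_ (𝟙_ C)).inv ≫ (parallelStates α l ⊗ₘ parallelStates β l) ≫ zipTensor A B l =
      parallelStates (fun x => (λ_ (𝟙_ C)).inv ≫ (α x ⊗ₘ β x)) l := by
  rw [← splitUnit_comp_parallelMaps β, zip_states_left, splitUnit_comp_parallelMaps]

omit [SymmetricCategory C] in
lemma parallelMaps_id {ι : Type} (A : ι → C) (l : List ι) :
    parallelMaps (fun x => 𝟙 (A x)) l = 𝟙 (tensorList l A) := by
  induction l with
  | nil => rfl
  | cons x l ih =>
    change 𝟙 (A x) ⊗ₘ parallelMaps _ l = 𝟙 (A x ⊗ tensorList l A)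
    rw [ih, id_tensorHom_id]

lemma parallelStates_wiring_cons {ε ι : Type} {A : ε → ι → C} (k : List ι)
    (ω : ∀ e, 𝟙_ C ⟶ tensorList k (A e)) (e : ε) (l : List ε) :
    parallelStates ω (e :: l) ≫ wiring A k (e :: l) =
      (λ_ (𝟙_ C)).inv ≫ (ω e ⊗ₘ (parallelStates ω l ≫ wiring A k l)) ≫
        zipTensor (A e) (fun i => tensorList l (fun e => A e i)) k := by
  change ((λ_ (𝟙_ C)).inv ≫ (ω e ⊗ₘ parallelStates ω l)) ≫
      (tensorList k (A e) ◁ wiring A k l) ≫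
        zipTensor (A e) (fun i => tensorList l (fun e => A e i)) k = _
  rw [Category.assoc, ← id_tensorHom, tensorHom_comp_tensorHom_assoc, Category.comp_id]

/-- A product state is a family of independent local preparations, which the wiring only regroups.
-/
lemma wiring_of_product {ε ι : Type} {A : ε → ι → C} (k : List ι)
    (ω : ∀ e, 𝟙_ C ⟶ tensorList k (A e)) (α : ∀ e i, 𝟙_ C ⟶ A e i) (l : List ε)
    (h : ∀ e ∈ l, ω e = parallelStates (α e) k) :
    parallelStates ω l ≫ wiring A k l =
      parallelStates (fun i => parallelStates (fun e => α e i) l) k := by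
  induction l with
  | nil =>
    change 𝟙 (𝟙_ C) ≫ splitUnit k = parallelStates (fun _ => 𝟙 (𝟙_ C)) k
    rw [← splitUnit_comp_parallelMaps, parallelMaps_id]
    simp
  | cons e l ih =>
    rw [parallelStates_wiring_cons, ih fun e' h' => h e' (by simp [h']), h e (by simp), zip_states]
    rfl

/-- If all sources but `e₀` emit product states, then the routed joint state is a local image of
the state emitted by `e₀`. -/
lemma wiring_of_product_of_ne {ε ι : Type} [DecidableEq ε] {A : ε → ι → C} (k : List ι)
    (ω : ∀ e, 𝟙_ C ⟶ tensorList k (A e)) (α : ∀ e i, 𝟙_ C ⟶ A e i) (l : List ε) (hl : l.Nodup)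
    (e₀ : ε) (h₀ : e₀ ∈ l) (h : ∀ e, e ≠ e₀ → ω e = parallelStates (α e) k) :
    parallelStates ω l ≫ wiring A k l =
      ω e₀ ≫ parallelMaps (fun i => insertFactor e₀ (fun e => α e i) l h₀) k := by
  induction l with
  | nil => simp at h₀
  | cons e l ih =>
    rw [List.nodup_cons] at hl
    rw [parallelStates_wiring_cons]
    by_cases he : e = e₀
    · subst he
      rw [wiring_of_product k ω α l fun e' h' => h e' (by rintro rfl; exact hl.1 h')]
      have := zip_states_right (fun i => parallelStates (fun e => α e i) l)
        (fun i => 𝟙 (A e i)) k (ω e)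
      rw [parallelMaps_id, Category.comp_id] at this
      rw [this]
      simp only [insertFactor_cons_self, id_tensorHom]
      rfl
    · have h' : e₀ ∈ l := List.mem_of_ne_of_mem (Ne.symm he) h₀
      rw [ih hl.2 h', h e he, zip_states_left]
      simp only [insertFactor_cons_of_ne he _ _ _ h']
      rfl

end Zip

end Tensor

/-! ### Deterministic events and causality -/

section Causal

variable {C : Type u} [Category.{v} C] [MonoidalCategory C] [SymmetricCategory C]

/-- An event is deterministic if it is a test with one outcome. -/
def OperationalTheory.IsDet (T : OperationalTheory C) {A B : C} (f : A ⟶ B) : Prop :=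
  T.IsTest (fun _ : Unit => f)

variable {T : OperationalTheory C}

lemma OperationalTheory.IsDet.comp {A B D : C} {f : A ⟶ B} {g : B ⟶ D} (hf : T.IsDet f)
    (hg : T.IsDet g) : T.IsDet (f ≫ g) :=
  T.relabel (Equiv.punitProd Unit).symm _ (T.test_comp _ _ hf hg)

lemma OperationalTheory.IsDet.tensor {A B D E : C} {f : A ⟶ B} {g : D ⟶ E} (hf : T.IsDet f)
    (hg : T.IsDet g) : T.IsDet (f ⊗ₘ g) :=
  T.relabel (Equiv.punitProd Unit).symm _ (T.test_tensor _ _ hf hg)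

lemma OperationalTheory.isDet_id (A : C) : T.IsDet (𝟙 A) := T.test_id A

lemma OperationalTheory.IsDet.whiskerLeft {A B D : C} {f : A ⟶ B} (hf : T.IsDet f) :
    T.IsDet (D ◁ f) := by
  rw [← id_tensorHom]
  exact (T.isDet_id D).tensor hf

lemma OperationalTheory.IsDet.whiskerRight {A B D : C} {f : A ⟶ B} (hf : T.IsDet f) :
    T.IsDet (f ▷ D) := by
  rw [← tensorHom_id]
  exact hf.tensor (T.isDet_id D)

lemma OperationalTheory.prob_id : T.prob (𝟙 (𝟙_ C)) = 1 := by
  simpa using T.prob_sum _ (T.test_id (𝟙_ C))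

section Det

variable {ι : Type} {A B : ι → C}

lemma isDet_parallelStates {s : ∀ x, 𝟙_ C ⟶ A x} (hs : ∀ x, T.IsDet (s x)) (l : List ι) :
    T.IsDet (parallelStates s l) := by
  induction l with
  | nil => exact T.isDet_id (𝟙_ C)
  | cons x l ih => exact OperationalTheory.IsDet.comp (T.test_leftUnitor_inv _) ((hs x).tensor ih)

lemma isDet_parallelEffects {a : ∀ x, A x ⟶ 𝟙_ C} {l : List ι}
    (ha : ∀ x ∈ l, T.IsDet (a x)) : T.IsDet (parallelEffects a l) := by
  induction l with
  | nil => exact T.isDet_id (𝟙_ C)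
  | cons x l ih =>
    exact OperationalTheory.IsDet.comp
      ((ha x (by simp)).tensor (ih fun y hy => ha y (by simp [hy]))) (T.test_leftUnitor_hom _)

lemma isDet_splitUnit (l : List ι) : T.IsDet (splitUnit (C := C) l) := by
  induction l with
  | nil => exact T.isDet_id (𝟙_ C)
  | cons x l ih =>
    exact OperationalTheory.IsDet.comp (T.test_leftUnitor_inv _) ih.whiskerLeft

lemma isDet_tensorμ (X₁ X₂ Y₁ Y₂ : C) : T.IsDet (tensorμ X₁ X₂ Y₁ Y₂) := by
  have h : ∀ A B D : C, T.IsDet (α_ A B D).hom := T.test_associator_hom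
  have h' : ∀ A B D : C, T.IsDet (α_ A B D).inv := T.test_associator_inv
  have hb : ∀ A B : C, T.IsDet (β_ A B).hom := T.test_braiding
  unfold tensorμ
  exact (h _ _ _).comp ((h' _ _ _).whiskerLeft.comp
    ((hb _ _).whiskerRight.whiskerLeft.comp ((h _ _ _).whiskerLeft.comp (h' _ _ _))))

lemma isDet_zipTensor (A B : ι → C) (l : List ι) : T.IsDet (zipTensor A B l) := by
  induction l with
  | nil => exact T.test_leftUnitor_hom (𝟙_ C)
  | cons x l ih =>
    exact (isDet_tensorμ _ _ _ _).comp ih.whiskerLeft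

lemma isDet_wiring {ε : Type} (A : ε → ι → C) (k : List ι) (l : List ε) :
    T.IsDet (wiring A k l) := by
  induction l with
  | nil => exact isDet_splitUnit k
  | cons e l ih => exact ih.whiskerLeft.comp (isDet_zipTensor _ _ k)

variable [DecidableEq ι]

lemma isDet_keepFactor {i : ι} {c : ∀ x, A x ⟶ 𝟙_ C} (hc : ∀ x, x ≠ i → T.IsDet (c x))
    {l : List ι} (hl : l.Nodup) (hi : i ∈ l) : T.IsDet (keepFactor i c l hi) := by
  induction l with
  | nil => simp at hi
  | cons x l ih =>
    rw [List.nodup_cons] at hl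
    by_cases hx : x = i
    · subst hx
      rw [keepFactor_cons_self]
      have h := isDet_parallelEffects (T := T) (a := c) (l := l) fun y hy =>
        hc y (by rintro rfl; exact hl.1 hy)
      exact OperationalTheory.IsDet.comp h.whiskerLeft (T.test_rightUnitor_hom _)
    · have h' : i ∈ l := List.mem_of_ne_of_mem (Ne.symm hx) hi
      rw [keepFactor_cons_of_ne hx _ _ _ h']
      exact OperationalTheory.IsDet.comp ((hc x hx).tensor (ih hl.2 h')) (T.test_leftUnitor_hom _)

lemma isDet_insertFactor {i : ι} {s : ∀ x, 𝟙_ C ⟶ A x} (hs : ∀ x, T.IsDet (s x))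
    {l : List ι} (hi : i ∈ l) : T.IsDet (insertFactor i s l hi) := by
  induction l with
  | nil => simp at hi
  | cons x l ih =>
    by_cases hx : x = i
    · subst hx
      rw [insertFactor_cons_self]
      exact OperationalTheory.IsDet.comp (T.test_rightUnitor_inv _)
        (isDet_parallelStates hs l).whiskerLeft
    · have h' : i ∈ l := List.mem_of_ne_of_mem (Ne.symm hx) hi
      rw [insertFactor_cons_of_ne hx _ _ _ h']
      exact OperationalTheory.IsDet.comp (T.test_leftUnitor_inv _) ((hs x).tensor (ih h'))

end Det

/-- The origin of the independence in the star: each factor is a closed circuit of its own. -/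
lemma prob_parallelStates_comp_parallelEffects {ι : Type} {A : ι → C} (s : ∀ x, 𝟙_ C ⟶ A x)
    (a : ∀ x, A x ⟶ 𝟙_ C) (l : List ι) :
    T.prob (parallelStates s l ≫ parallelEffects a l) =
      (l.map fun x => T.prob (s x ≫ a x)).prod := by
  induction l with
  | nil =>
    change T.prob (𝟙 (𝟙_ C) ≫ 𝟙 (𝟙_ C)) = 1
    rw [Category.comp_id, OperationalTheory.prob_id]
  | cons x l ih =>
    change T.prob (((λ_ (𝟙_ C)).inv ≫ (s x ⊗ₘ parallelStates s l)) ≫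
      (a x ⊗ₘ parallelEffects a l) ≫ (λ_ (𝟙_ C)).hom) = _
    rw [Category.assoc, tensorHom_comp_tensorHom_assoc, scalar_tensor, T.prob_comp, ih,
      List.map_cons, List.prod_cons]

variable (hT : T.IsCausal)

/-- The discarding of a system. -/
noncomputable def OperationalTheory.IsCausal.discard (A : C) : A ⟶ 𝟙_ C := (hT A).choose

lemma OperationalTheory.IsCausal.isDet_discard (A : C) : T.IsDet (hT.discard A) :=
  (hT A).choose_spec.1

include hT in
lemma OperationalTheory.IsCausal.effect_unique {A : C} {f g : A ⟶ 𝟙_ C} (hf : T.IsDet f)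
    (hg : T.IsDet g) : f = g :=
  (hT A).unique hf hg

/-- No signalling: a deterministic operation on a system that is discarded afterwards leaves no
trace. -/
lemma OperationalTheory.IsCausal.comp_discard {A B : C} {f : A ⟶ B} (hf : T.IsDet f) :
    f ≫ hT.discard B = hT.discard A :=
  hT.effect_unique (hf.comp (hT.isDet_discard B)) (hT.isDet_discard A)

lemma OperationalTheory.IsCausal.eq_discard {A : C} {f : A ⟶ 𝟙_ C} (hf : T.IsDet f) :
    f = hT.discard A := hT.effect_unique hf (hT.isDet_discard A)

include hT in
lemma OperationalTheory.IsCausal.eq_id {f : 𝟙_ C ⟶ 𝟙_ C} (hf : T.IsDet f) : f = 𝟙 (𝟙_ C) :=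
  hT.effect_unique hf (T.isDet_id _)

/-- A test whose outcomes are summed over is a discarding. -/
lemma OperationalTheory.IsCausal.sum_prob {B : C} {X : Type} [Fintype X] (t : X → (B ⟶ 𝟙_ C))
    (ht : T.IsTest t) (ψ : 𝟙_ C ⟶ B) :
    ∑ x, T.prob (ψ ≫ t x) = T.prob (ψ ≫ hT.discard B) := by
  classical
  -- Coarse-graining needs a surjection onto `Unit`. A test without outcomes, run after a test
  -- containing `ψ`, would be a closed test of total probability `0`.
  have hX : Nonempty X := by
    by_contra hX
    rw [not_nonempty_iff] at hX
    obtain ⟨Y, _, r, hr, -⟩ := T.event_mem ψ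
    have := T.prob_sum _ (T.test_comp r t hr ht)
    simp at this
  obtain ⟨s, hs, h⟩ := T.coarseGrain (fun _ : X => ()) t
    (fun _ => ⟨hX.some, rfl⟩) ht
  -- With all outcomes merged into one, the test is deterministic, hence the discarding. The ancilla
  -- is taken trivial.
  have h' := h () (𝟙_ C) (ψ ≫ (ρ_ B).inv) (ρ_ (𝟙_ C)).hom
  have e : ∀ f : B ⟶ 𝟙_ C, (ψ ≫ (ρ_ B).inv) ≫ f ▷ 𝟙_ C ≫ (ρ_ (𝟙_ C)).hom = ψ ≫ f := by
    intro f
    rw [rightUnitor_naturality, Category.assoc, Iso.inv_hom_id_assoc]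
  simp only [e, Finset.filter_true] at h'
  rw [← h', hT.eq_discard (f := s ()) hs]

/-- Uniqueness makes discarding the trivial system an identity; `j` serves to cancel a discarding.
-/
lemma OperationalTheory.IsCausal.exists_section_of_eq_unit {B : C} (hB : B = 𝟙_ C) :
    ∃ j : 𝟙_ C ⟶ B, hT.discard B ≫ j = 𝟙 B := by
  subst hB
  exact ⟨𝟙 _, by rw [hT.eq_id (hT.isDet_discard _), Category.comp_id]⟩

/-- A deterministic state of a composite with a trivial system is the product of its marginals. -/
lemma OperationalTheory.IsCausal.eq_product_of_section {P Q : C} {ω : 𝟙_ C ⟶ P ⊗ Q}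
    (hω : T.IsDet ω) (h : (∃ j, hT.discard P ≫ j = 𝟙 P) ∨ ∃ j, hT.discard Q ≫ j = 𝟙 Q) :
    ω = (λ_ (𝟙_ C)).inv ≫ ((ω ≫ (P ◁ hT.discard Q) ≫ (ρ_ P).hom) ⊗ₘ
      (ω ≫ (hT.discard P ▷ Q) ≫ (λ_ Q).hom)) := by
  have hP : T.IsDet (ω ≫ (P ◁ hT.discard Q) ≫ (ρ_ P).hom) :=
    hω.comp ((hT.isDet_discard Q).whiskerLeft.comp (T.test_rightUnitor_hom P))
  have hQ : T.IsDet (ω ≫ (hT.discard P ▷ Q) ≫ (λ_ Q).hom) :=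
    hω.comp ((hT.isDet_discard P).whiskerRight.comp (T.test_leftUnitor_hom Q))
  -- Once the trivial factor is discarded, both sides reduce to the marginal on the other factor;
  -- composing with `j` undoes that discarding.
  rcases h with ⟨j, hj⟩ | ⟨j, hj⟩
  · have key : ω ≫ (hT.discard P ▷ Q) = ((λ_ (𝟙_ C)).inv ≫
        ((ω ≫ (P ◁ hT.discard Q) ≫ (ρ_ P).hom) ⊗ₘ (ω ≫ (hT.discard P ▷ Q) ≫ (λ_ Q).hom))) ≫
        (hT.discard P ▷ Q) := by
      rw [Category.assoc, ← tensorHom_id, tensorHom_comp_tensorHom, hT.eq_id (hP.comp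
        (hT.isDet_discard P)), id_tensorHom, Category.comp_id, tensorHom_id,
        ← leftUnitor_inv_naturality, Category.assoc, Category.assoc, Iso.hom_inv_id,
        Category.comp_id]
    have := congrArg (· ≫ (j ▷ Q)) key
    simpa only [Category.assoc, ← comp_whiskerRight, hj, id_whiskerRight, Category.comp_id]
      using this
  · have key : ω ≫ (P ◁ hT.discard Q) = ((λ_ (𝟙_ C)).inv ≫
        ((ω ≫ (P ◁ hT.discard Q) ≫ (ρ_ P).hom) ⊗ₘ (ω ≫ (hT.discard P ▷ Q) ≫ (λ_ Q).hom))) ≫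
        (P ◁ hT.discard Q) := by
      rw [Category.assoc, ← id_tensorHom, tensorHom_comp_tensorHom, hT.eq_id (hQ.comp
        (hT.isDet_discard Q)), tensorHom_id, Category.comp_id, id_tensorHom, unitors_inv_equal,
        ← rightUnitor_inv_naturality, Category.assoc, Category.assoc, Iso.hom_inv_id,
        Category.comp_id]
    have := congrArg (· ≫ (P ◁ j)) key
    simpa only [Category.assoc, ← whiskerLeft_comp, hj, MonoidalCategory.whiskerLeft_id,
      Category.comp_id] using this

section Projection

variable {ι : Type} [DecidableEq ι]

/-- Discarding the factors outside of a sublist. -/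
lemma OperationalTheory.IsCausal.exists_projection {k' k : List ι} (h : k'.Sublist k)
    (hk : k.Nodup) :
    ∃ π : ∀ A : ι → C, tensorList k A ⟶ tensorList k' A,
      (∀ A, T.IsDet (π A)) ∧
      (∀ A B, zipTensor A B k ≫ π (fun x => A x ⊗ B x) = (π A ⊗ₘ π B) ≫ zipTensor A B k') ∧
      splitUnit k ≫ π (fun _ => 𝟙_ C) = splitUnit k' ∧
      (∀ (A : ι → C) (a : ∀ x, A x ⟶ 𝟙_ C), (∀ x ∈ k, x ∉ k' → a x = hT.discard (A x)) →
        parallelEffects a k = π A ≫ parallelEffects a k') ∧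
      (∀ (A : ι → C) x (hx' : x ∈ k') (hx : x ∈ k),
        π A ≫ keepFactor x (fun y => hT.discard (A y)) k' hx' =
          keepFactor x (fun y => hT.discard (A y)) k hx) := by
  -- A single `π` serves all families `A`, because the induction along `wiring` changes the family;
  -- compatibility with `zipTensor` and `splitUnit` is what carries `π` through it.
  induction h with
  | slnil =>
    refine ⟨fun A => 𝟙 (𝟙_ C), fun A => T.isDet_id (𝟙_ C), fun A B => ?_, ?_, fun A a _ => ?_,
      fun A x hx' => by simp at hx'⟩
    · change (λ_ (𝟙_ C)).hom ≫ 𝟙 (𝟙_ C) = (𝟙 (𝟙_ C) ⊗ₘ 𝟙 (𝟙_ C)) ≫ (λ_ (𝟙_ C)).hom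
      simp
    · exact Category.id_comp (𝟙 (𝟙_ C))
    · exact (Category.id_comp (𝟙 (𝟙_ C))).symm
  | @cons k' k x h ih =>
    rw [List.nodup_cons] at hk
    obtain ⟨π, hd, hz, hs, he, hf⟩ := ih hk.2
    refine ⟨fun A => (hT.discard (A x) ⊗ₘ π A) ≫ (λ_ (tensorList k' A)).hom, fun A => ?_,
      fun A B => ?_, ?_, fun A a ha => ?_, fun A y hy' hy => ?_⟩
    · exact OperationalTheory.IsDet.comp ((hT.isDet_discard _).tensor (hd A))
        (T.test_leftUnitor_hom _)
    · change (tensorμ (A x) (tensorList k A) (B x) (tensorList k B) ≫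
          ((A x ⊗ B x) ◁ zipTensor A B k)) ≫ (hT.discard (A x ⊗ B x) ⊗ₘ π _) ≫
            (λ_ (tensorList k' _)).hom =
        (((hT.discard (A x) ⊗ₘ π A) ≫ (λ_ (tensorList k' A)).hom) ⊗ₘ
          ((hT.discard (B x) ⊗ₘ π B) ≫ (λ_ (tensorList k' B)).hom)) ≫ zipTensor A B k'
      -- By uniqueness, discarding a composite is discarding its parts.
      have e : hT.discard (A x ⊗ B x) =
          (hT.discard (A x) ⊗ₘ hT.discard (B x)) ≫ (λ_ (𝟙_ C)).hom :=
        (hT.eq_discard (((hT.isDet_discard _).tensor (hT.isDet_discard _)).comp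
          (T.test_leftUnitor_hom _))).symm
      rw [Category.assoc, ← id_tensorHom, tensorHom_comp_tensorHom_assoc, hz, Category.id_comp, e,
        ← tensorHom_comp_tensorHom, Category.assoc, ← tensorHom_comp_tensorHom, leftUnitor_monoidal,
        Category.assoc, Category.assoc, tensorμ_natural_assoc, MonoidalCategory.tensorHom_def (λ_ (𝟙_ C)).hom]
      simp only [Category.assoc, leftUnitor_naturality]
    · change ((λ_ (𝟙_ C)).inv ≫ (𝟙_ C ◁ splitUnit k)) ≫ (hT.discard (𝟙_ C) ⊗ₘ π _) ≫
        (λ_ (tensorList k' _)).hom = _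
      rw [hT.eq_id (hT.isDet_discard _), id_tensorHom, Category.assoc, ← whiskerLeft_comp_assoc,
        hs, leftUnitor_naturality, Iso.inv_hom_id_assoc]
    · change (a x ⊗ₘ parallelEffects a k) ≫ (λ_ (𝟙_ C)).hom =
        ((hT.discard (A x) ⊗ₘ π A) ≫ (λ_ (tensorList k' A)).hom) ≫ parallelEffects a k'
      rw [he A a fun y hy hy' => ha y (by simp [hy]) hy', ha x (by simp) fun hx =>
        hk.1 (h.subset hx), Category.assoc, ← leftUnitor_naturality, ← id_tensorHom,
        tensorHom_comp_tensorHom_assoc, Category.comp_id]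
    · have hxy : x ≠ y := by rintro rfl; exact hk.1 (h.subset hy')
      rw [keepFactor_cons_of_ne hxy _ _ _ (h.subset hy'), ← hf A y hy' (h.subset hy')]
      change ((hT.discard (A x) ⊗ₘ π A) ≫ (λ_ (tensorList k' A)).hom) ≫ keepFactor y _ k' hy' =
        (hT.discard (A x) ⊗ₘ (π A ≫ keepFactor y _ k' hy')) ≫ (λ_ (A y)).hom
      rw [Category.assoc, ← leftUnitor_naturality, ← id_tensorHom,
        tensorHom_comp_tensorHom_assoc, Category.comp_id]
  | @cons_cons k' k x h ih =>
    rw [List.nodup_cons] at hk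
    obtain ⟨π, hd, hz, hs, he, hf⟩ := ih hk.2
    refine ⟨fun A => A x ◁ π A, fun A => (hd A).whiskerLeft, fun A B => ?_, ?_, fun A a ha => ?_,
      fun A y hy' hy => ?_⟩
    · change (tensorμ (A x) (tensorList k A) (B x) (tensorList k B) ≫
          ((A x ⊗ B x) ◁ zipTensor A B k)) ≫ ((A x ⊗ B x) ◁ π _) =
        ((A x ◁ π A) ⊗ₘ (B x ◁ π B)) ≫ tensorμ (A x) (tensorList k' A) (B x) (tensorList k' B) ≫
          ((A x ⊗ B x) ◁ zipTensor A B k')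
      have := tensorμ_natural (𝟙 (A x)) (π A) (𝟙 (B x)) (π B)
      simp only [id_tensorHom, MonoidalCategory.whiskerLeft_id] at this
      rw [reassoc_of% this, Category.assoc, ← whiskerLeft_comp, hz, whiskerLeft_comp]
    · change ((λ_ (𝟙_ C)).inv ≫ (𝟙_ C ◁ splitUnit k)) ≫ (𝟙_ C ◁ π _) =
        (λ_ (𝟙_ C)).inv ≫ (𝟙_ C ◁ splitUnit k')
      rw [Category.assoc, ← whiskerLeft_comp, hs]
    · change (a x ⊗ₘ parallelEffects a k) ≫ (λ_ (𝟙_ C)).hom =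
        (A x ◁ π A) ≫ (a x ⊗ₘ parallelEffects a k') ≫ (λ_ (𝟙_ C)).hom
      have hax : ∀ y ∈ k, y ∉ k' → a y = hT.discard (A y) := fun y hy hy' =>
        ha y (by simp [hy]) (by simpa [hy'] using by rintro rfl; exact hk.1 hy)
      rw [he A a hax, ← id_tensorHom, tensorHom_comp_tensorHom_assoc, Category.id_comp]
    · by_cases hxy : x = y
      · subst hxy
        rw [keepFactor_cons_self, keepFactor_cons_self]
        have e : π A ≫ parallelEffects (fun y => hT.discard (A y)) k' =
            parallelEffects (fun y => hT.discard (A y)) k := (he A _ fun _ _ _ => rfl).symm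
        rw [← e]
        change (A x ◁ π A) ≫ (A x ◁ parallelEffects _ k') ≫ (ρ_ (A x)).hom = _
        rw [whiskerLeft_comp_assoc]
      · have h1 : y ∈ k' := List.mem_of_ne_of_mem (Ne.symm hxy) hy'
        rw [keepFactor_cons_of_ne hxy _ _ _ h1, keepFactor_cons_of_ne hxy _ _ _ (h.subset h1),
          ← hf A y h1 (h.subset h1)]
        change (A x ◁ π A) ≫ (hT.discard (A x) ⊗ₘ keepFactor y _ k' h1) ≫ (λ_ (A y)).hom = _
        rw [← id_tensorHom, tensorHom_comp_tensorHom_assoc, Category.id_comp]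

end Projection

end Causal

/-! ### Circuits with two parties left -/

section Pair

variable {C : Type u} [Category.{v} C] [MonoidalCategory C] [SymmetricCategory C]
  {T : OperationalTheory C} (hT : T.IsCausal) {ι : Type} [DecidableEq ι]

/-- The local marginals of a joint state. -/
noncomputable def OperationalTheory.IsCausal.marginal {A : ι → C} {k : List ι}
    (ω : 𝟙_ C ⟶ tensorList k A) (i : ι) (hi : i ∈ k) : 𝟙_ C ⟶ A i :=
  ω ≫ keepFactor i (fun y => hT.discard (A y)) k hi

lemma OperationalTheory.IsCausal.isDet_marginal {A : ι → C} {k : List ι} (hk : k.Nodup)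
    {ω : 𝟙_ C ⟶ tensorList k A} (hω : T.IsDet ω) (i : ι) (hi : i ∈ k) :
    T.IsDet (hT.marginal ω i hi) :=
  hω.comp (isDet_keepFactor (fun _ _ => hT.isDet_discard _) hk hi)

/-- A deterministic state of two systems, one of which is trivial, is the product of
its marginals. -/
lemma OperationalTheory.IsCausal.eq_parallelStates_of_unit {A : ι → C} {u w : ι} (huw : u ≠ w)
    {ω : 𝟙_ C ⟶ tensorList [u, w] A} (hω : T.IsDet ω) (h : A u = 𝟙_ C ∨ A w = 𝟙_ C)
    (α : ∀ x, 𝟙_ C ⟶ A x) (hu : α u = hT.marginal ω u (by simp))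
    (hw : α w = hT.marginal ω w (by simp)) :
    ω = parallelStates α [u, w] := by
  have h' : (∃ j, hT.discard (A u) ≫ j = 𝟙 (A u)) ∨
      ∃ j, hT.discard (A w ⊗ 𝟙_ C) ≫ j = 𝟙 (A w ⊗ 𝟙_ C) := by
    refine h.imp hT.exists_section_of_eq_unit fun h => ?_
    obtain ⟨j, hj⟩ := hT.exists_section_of_eq_unit h
    refine ⟨j ≫ (ρ_ _).inv, ?_⟩
    have e : hT.discard (A w ⊗ 𝟙_ C) = (ρ_ (A w)).hom ≫ hT.discard (A w) :=
      (hT.comp_discard (T.test_rightUnitor_hom (A w))).symm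
    rw [e, Category.assoc, reassoc_of% hj, Iso.hom_inv_id]
  -- The composite over `[u, w]` ends in a unit factor, so the second system is `A w ⊗ 𝟙_ C`.
  obtain ⟨ω', rfl⟩ : ∃ ω' : 𝟙_ C ⟶ A u ⊗ (A w ⊗ 𝟙_ C), ω' = ω := ⟨ω, rfl⟩
  have key := hT.eq_product_of_section (P := A u) (Q := A w ⊗ 𝟙_ C) (ω := ω') hω h'
  have eu : α u = ω' ≫ (A u ◁ hT.discard (A w ⊗ 𝟙_ C)) ≫ (ρ_ (A u)).hom := by
    rw [hu]
    change ω' ≫ keepFactor (A := A) u (fun y => hT.discard (A y)) [u, w] _ = _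
    rw [keepFactor_cons_self, hT.eq_discard
      (isDet_parallelEffects (fun _ _ => hT.isDet_discard _))]
    rfl
  have ew : α w ≫ (ρ_ (A w)).inv = ω' ≫ (hT.discard (A u) ▷ (A w ⊗ 𝟙_ C)) ≫
      (λ_ (A w ⊗ 𝟙_ C)).hom := by
    rw [hw]
    change (ω' ≫ keepFactor (A := A) w (fun y => hT.discard (A y)) [u, w] _) ≫ _ = _
    rw [keepFactor_cons_of_ne huw _ _ _ (by simp),
      keepFactor_cons_self]
    change (ω' ≫ (hT.discard (A u) ⊗ₘ ((A w ◁ 𝟙 (𝟙_ C)) ≫ (ρ_ (A w)).hom)) ≫ (λ_ (A w)).hom) ≫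
      (ρ_ (A w)).inv = _
    rw [MonoidalCategory.whiskerLeft_id, Category.id_comp, Category.assoc, Category.assoc,
      MonoidalCategory.tensorHom_def, Category.assoc, leftUnitor_naturality_assoc,
      Iso.hom_inv_id, Category.comp_id]
  refine key.trans ?_
  change _ = (λ_ (𝟙_ C)).inv ≫ (α u ⊗ₘ ((λ_ (𝟙_ C)).inv ≫ (α w ⊗ₘ 𝟙 (𝟙_ C))))
  rw [← eu, ← ew, tensorHom_id, unitors_inv_equal, rightUnitor_inv_naturality]

variable {ε : Type} [DecidableEq ε]

-- Discarding parties after the routing amounts to discarding their wires at the sources.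
omit [DecidableEq ι] [DecidableEq ε] in
lemma wiring_comp_projection {k k' : List ι} {π : ∀ A : ι → C, tensorList k A ⟶ tensorList k' A}
    (hz : ∀ A B, zipTensor A B k ≫ π (fun x => A x ⊗ B x) = (π A ⊗ₘ π B) ≫ zipTensor A B k')
    (hs : splitUnit k ≫ π (fun _ => 𝟙_ C) = splitUnit k') (A : ε → ι → C) (l : List ε) :
    wiring A k l ≫ π (fun i => tensorList l fun e => A e i) =
      parallelMaps (fun e => π (A e)) l ≫ wiring A k' l := by
  induction l with
  | nil =>
    change splitUnit k ≫ π (fun _ => 𝟙_ C) = 𝟙 (𝟙_ C) ≫ splitUnit k'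
    rw [hs, Category.id_comp]
  | cons e l ih =>
    change ((tensorList k (A e) ◁ wiring A k l) ≫
      zipTensor (A e) (fun i => tensorList l fun e => A e i) k) ≫
        π (fun i => A e i ⊗ tensorList l fun e => A e i) =
      (π (A e) ⊗ₘ parallelMaps (fun e => π (A e)) l) ≫ (tensorList k' (A e) ◁ wiring A k' l) ≫
        zipTensor (A e) (fun i => tensorList l fun e => A e i) k'
    rw [Category.assoc, hz, ← id_tensorHom, tensorHom_comp_tensorHom_assoc, Category.id_comp, ih,
      ← id_tensorHom, tensorHom_comp_tensorHom_assoc, Category.comp_id]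

/-- If all parties but `u` and `w` are discarded and `e₀` is the only source shared by
these two, then the other sources can be replaced by their local marginals. -/
lemma OperationalTheory.IsCausal.circuit_of_pair {A : ε → ι → C} {k : List ι} (hk : k.Nodup)
    (hk' : ∀ x, x ∈ k) {l : List ε} (hl : l.Nodup) {s : ∀ e, 𝟙_ C ⟶ tensorList k (A e)}
    (hs : ∀ e, T.IsDet (s e)) {u w : ι} (huw : u ≠ w) (hsub : [u, w].Sublist k) {e₀ : ε}
    (h₀ : e₀ ∈ l) (hA : ∀ e, e ≠ e₀ → A e u = 𝟙_ C ∨ A e w = 𝟙_ C)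
    (a : ∀ x, tensorList l (fun e => A e x) ⟶ 𝟙_ C)
    (ha : ∀ x, x ≠ u → x ≠ w → a x = hT.discard _) :
    parallelStates s l ≫ wiring A k l ≫ parallelEffects a k =
      s e₀ ≫ parallelEffects
        (fun x => insertFactor e₀ (fun e => hT.marginal (s e) x (hk' x)) l h₀ ≫ a x) k := by
  obtain ⟨π, hd, hz, hsp, he, hf⟩ := hT.exists_projection hsub hk
  have hm : ∀ x e, T.IsDet (hT.marginal (s e) x (hk' x)) := fun x e =>
    hT.isDet_marginal hk (hs e) x _
  -- Both sides are projected to `u` and `w`. The projection then moves to the sources, all of which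
  -- except `e₀` become product states.
  rw [he _ a fun x _ hx => ha x (by rintro rfl; simp at hx) (by rintro rfl; simp at hx),
    he (A e₀) _ fun x _ hx => ?_, ← Category.assoc (wiring A k l), wiring_comp_projection hz hsp,
    Category.assoc, ← Category.assoc, parallelStates_comp_parallelMaps, ← Category.assoc,
    wiring_of_product_of_ne [u, w] _ (fun e x => hT.marginal (s e) x (hk' x)) l hl e₀ h₀,
    Category.assoc, parallelMaps_comp_parallelEffects, Category.assoc]
  · intro e h
    refine hT.eq_parallelStates_of_unit huw ((hs e).comp (hd _)) (hA e h) _ ?_ ?_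
    · simp only [OperationalTheory.IsCausal.marginal, Category.assoc]
      rw [hf]
    · simp only [OperationalTheory.IsCausal.marginal, Category.assoc]
      rw [hf]
  · rw [ha x (by rintro rfl; simp at hx) (by rintro rfl; simp at hx),
      hT.comp_discard (isDet_insertFactor (hm x) h₀)]

end Pair

/-! ### Sources as two-element sets -/

lemma SourceNode.exists_pair {n : ℕ} {i j : Fin n} (h : i ≠ j) :
    ∃ e : SourceNode n 2, i ∈ e.1 ∧ j ∈ e.1 :=
  ⟨⟨{i, j}, Finset.card_pair h⟩, by simp⟩

lemma SourceNode.eq_pair {n : ℕ} {i j : Fin n} (h : i ≠ j) {e : SourceNode n 2} (hi : i ∈ e.1)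
    (hj : j ∈ e.1) : e.1 = {i, j} :=
  (Finset.eq_of_subset_of_card_le (by simp [Finset.insert_subset_iff, hi, hj])
    (by rw [e.2, Finset.card_pair h])).symm

lemma SourceNode.eq_of_mem {n : ℕ} {i j : Fin n} (h : i ≠ j) {e e' : SourceNode n 2}
    (hi : i ∈ e.1) (hj : j ∈ e.1) (hi' : i ∈ e'.1) (hj' : j ∈ e'.1) : e = e' :=
  Subtype.ext ((SourceNode.eq_pair h hi hj).trans (SourceNode.eq_pair h hi' hj').symm)

lemma SourceNode.exists_other {n : ℕ} (i : Fin n) (e : SourceNode n 2) :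
    ∃ j, j ≠ i ∧ j ∈ e.1 := by
  obtain ⟨j, hj, hji⟩ := Finset.exists_mem_ne (by rw [e.2]; norm_num) i
  exact ⟨j, hji, hj⟩

/-! ### The star around a party -/

namespace GBN

variable {C : Type u} [Category.{v} C] [MonoidalCategory C] [SymmetricCategory C]
  {T : OperationalTheory C} (hT : T.IsCausal) {n : ℕ} {X : Fin n → Type} [∀ i, Fintype (X i)]
  (N : GBN T n 2 X)

/-- The composite of the systems entering party `k`. -/
noncomputable abbrev party (k : Fin n) : C :=
  tensorList (Finset.univ : Finset (SourceNode n 2)).toList (fun I => edgeSystem N.edge I k)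

lemma mem_sources (e : SourceNode n 2) : e ∈ (Finset.univ : Finset (SourceNode n 2)).toList :=
  Finset.mem_toList.2 (Finset.mem_univ e)

/-- The probability of the circuit of the network closed by the effects `a k`. -/
noncomputable def circuit (a : ∀ k, N.party k ⟶ 𝟙_ C) : ℝ :=
  T.prob (parallelStates N.source (Finset.univ : Finset (SourceNode n 2)).toList ≫
    wiring (edgeSystem N.edge) (List.finRange n)
      (Finset.univ : Finset (SourceNode n 2)).toList ≫
    parallelEffects a (List.finRange n))

/-- The system sent from `e` to `k`, completed to all systems entering party `k` by the local
marginals of the other sources. -/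
noncomputable def complete (e : SourceNode n 2) (k : Fin n) :
    edgeSystem N.edge e k ⟶ N.party k :=
  insertFactor e (fun e' => hT.marginal (N.source e') k (List.mem_finRange k)) _ (mem_sources e)

lemma isDet_complete (e : SourceNode n 2) (k : Fin n) : T.IsDet (N.complete hT e k) :=
  isDet_insertFactor (fun e' => hT.isDet_marginal (List.nodup_finRange n) (N.source_isTest e') _ _)
    _

open Classical in
/-- The effects applied to the outgoing systems of the source `e` in the star around `i`. -/
noncomputable def starEffect (i : Fin n) (e : SourceNode n 2) (a : ∀ k, N.party k ⟶ 𝟙_ C)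
    (k : Fin n) : edgeSystem N.edge e k ⟶ 𝟙_ C :=
  if i ∈ e.1 ∧ k ∈ e.1 then N.complete hT e k ≫ a k else hT.discard _

/-- The state that party `i` gets from the source `e` in the star around `i`. -/
noncomputable def starState (i : Fin n) (e : SourceNode n 2) (a : ∀ k, N.party k ⟶ 𝟙_ C) :
    𝟙_ C ⟶ edgeSystem N.edge e i :=
  N.source e ≫ keepFactor i (N.starEffect hT i e a) (List.finRange n) (List.mem_finRange i)

/-- The probability of the circuit in which party `i` shares its sources with the other parties,
while every other party has private copies of its remaining sources. -/
noncomputable def star (i : Fin n) (a : ∀ k, N.party k ⟶ 𝟙_ C) : ℝ :=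
  T.prob (parallelStates (fun e => N.starState hT i e a)
    (Finset.univ : Finset (SourceNode n 2)).toList ≫ a i)

lemma starEffect_congr {i : Fin n} {e : SourceNode n 2} {a b : ∀ k, N.party k ⟶ 𝟙_ C} {k : Fin n}
    (h : i ∈ e.1 → k ∈ e.1 → a k = b k) : N.starEffect hT i e a k = N.starEffect hT i e b k := by
  unfold starEffect
  split_ifs with hk
  · rw [h hk.1 hk.2]
  · rfl

lemma starEffect_discard (i : Fin n) (e : SourceNode n 2) {a : ∀ k, N.party k ⟶ 𝟙_ C} {k : Fin n}
    (h : i ∈ e.1 → k ∈ e.1 → a k = hT.discard _) :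
    N.starEffect hT i e a k = hT.discard _ := by
  unfold starEffect
  split_ifs with hk
  · rw [h hk.1 hk.2, hT.comp_discard (N.isDet_complete hT e k)]
  · rfl

/-- The state reaching `i` from `e` depends only on the effect at the other end of `e`. -/
lemma starState_congr {i : Fin n} {e : SourceNode n 2} {a b : ∀ k, N.party k ⟶ 𝟙_ C}
    (h : ∀ k, k ≠ i → i ∈ e.1 → k ∈ e.1 → a k = b k) :
    N.starState hT i e a = N.starState hT i e b := by
  unfold starState
  rw [keepFactor_congr (List.nodup_finRange n) _ fun k hk => N.starEffect_congr hT (h k hk)]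

lemma starState_discard {i : Fin n} {e : SourceNode n 2} {a : ∀ k, N.party k ⟶ 𝟙_ C}
    (h : ∀ k, k ≠ i → i ∈ e.1 → k ∈ e.1 → a k = hT.discard _) :
    N.starState hT i e a = hT.marginal (N.source e) i (List.mem_finRange i) := by
  unfold starState OperationalTheory.IsCausal.marginal
  rw [keepFactor_congr (List.nodup_finRange n) _ fun k hk => N.starEffect_discard hT i e (h k hk)]

lemma sum_circuit {Y : Type} [Fintype Y] (a : ∀ k, N.party k ⟶ 𝟙_ C) (k : Fin n)
    (t : Y → (N.party k ⟶ 𝟙_ C)) (ht : T.IsTest t) :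
    ∑ y, N.circuit (Function.update a k (t y)) =
      N.circuit (Function.update a k (hT.discard _)) := by
  have h : ∀ f, N.circuit (Function.update a k f) =
      T.prob ((parallelStates N.source _ ≫ wiring (edgeSystem N.edge) (List.finRange n) _ ≫
        keepFactor k a (List.finRange n) (List.mem_finRange k)) ≫ f) := by
    intro f
    unfold circuit
    rw [← keepFactor_comp _ (List.mem_finRange k), keepFactor_congr (c' := a)
      (List.nodup_finRange n) _ fun j hj => Function.update_of_ne hj _ _, Function.update_self]
    simp only [Category.assoc]
  simp only [h]
  exact hT.sum_prob t ht _

/-- Unfolds the star at the source shared by `i` and `k`. The states from the other sources are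
absorbed into the effect of `i`, and they do not involve the effect of `k`. -/
lemma star_eq_of_mem {i k : Fin n} (hk : k ≠ i) {e : SourceNode n 2} (hi : i ∈ e.1)
    (hke : k ∈ e.1) (a b : ∀ k, N.party k ⟶ 𝟙_ C) (h : ∀ j, j ≠ k → b j = a j) :
    N.star hT i b = T.prob (N.source e ≫ parallelEffects (Function.update
      (N.starEffect hT i e b) i (insertFactor e (fun e' => N.starState hT i e' a) _
        (mem_sources e) ≫ a i)) (List.finRange n)) := by
  unfold star
  rw [← comp_insertFactor _ (mem_sources e), insertFactor_congr (Finset.nodup_toList _) _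
    (s' := fun e' => N.starState hT i e' a) fun e' he' => ?_, h i hk.symm]
  · rw [← keepFactor_comp _ (List.mem_finRange i), keepFactor_congr (List.nodup_finRange n) _
      fun j hj => Function.update_of_ne hj _ _, Function.update_self]
    simp only [starState, Category.assoc]
  · refine N.starState_congr hT fun j _ h1 h2 => h j ?_
    rintro rfl
    exact he' (SourceNode.eq_of_mem hk h2 h1 hke hi)

/-- Each party's effect occurs once in the star, so the star is `T.prob (ψ ≫ f)` as a function of
it. -/
lemma sum_star {Y : Type} [Fintype Y] (i : Fin n) (a : ∀ k, N.party k ⟶ 𝟙_ C) (k : Fin n)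
    (t : Y → (N.party k ⟶ 𝟙_ C)) (ht : T.IsTest t) :
    ∑ y, N.star hT i (Function.update a k (t y)) =
      N.star hT i (Function.update a k (hT.discard _)) := by
  by_cases hk : k = i
  · subst hk
    have h : ∀ f, N.star hT k (Function.update a k f) =
        T.prob (parallelStates (fun e => N.starState hT k e a) _ ≫ f) := by
      intro f
      unfold star
      rw [Function.update_self, parallelStates_congr fun e _ => N.starState_congr hT fun j hj _ _ =>
        Function.update_of_ne hj _ _]
    simp only [h]
    exact hT.sum_prob t ht _
  · obtain ⟨e, hi, hke⟩ := SourceNode.exists_pair (Ne.symm hk)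
    have h : ∀ f, N.star hT i (Function.update a k f) =
        T.prob ((N.source e ≫ keepFactor k (Function.update (N.starEffect hT i e a) i
          (insertFactor e (fun e' => N.starState hT i e' a) _ (mem_sources e) ≫ a i))
            (List.finRange n) (List.mem_finRange k) ≫ N.complete hT e k) ≫ f) := by
      intro f
      rw [N.star_eq_of_mem hT hk hi hke a _ fun j hj => Function.update_of_ne hj _ _,
        ← keepFactor_comp _ (List.mem_finRange k)]
      rw [keepFactor_congr (c' := Function.update (N.starEffect hT i e a) i
          (insertFactor e (fun e' => N.starState hT i e' a) _ (mem_sources e) ≫ a i))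
          (List.nodup_finRange n) _ fun j hj => ?_, Function.update_of_ne hk]
      · simp [starEffect, hi, hke]
      · by_cases hj' : j = i
        · subst hj'
          simp
        · rw [Function.update_of_ne hj', Function.update_of_ne hj']
          exact N.starEffect_congr hT fun _ _ => Function.update_of_ne hj _ _
    simp only [h]
    exact hT.sum_prob t ht _

/-- The star around `i` reproduces the joint behaviour of `i` and any other party. -/
lemma star_eq_circuit {i j : Fin n} (hj : j ≠ i) (a : ∀ k, N.party k ⟶ 𝟙_ C)
    (ha : ∀ k, k ≠ i → k ≠ j → a k = hT.discard _) : N.star hT i a = N.circuit a := by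
  classical
  obtain ⟨e, hi, hje⟩ := SourceNode.exists_pair (Ne.symm hj)
  -- `List.finRange n` is increasing, so the pair must be taken in increasing order to be a sublist.
  have key : ∀ u w : Fin n, u < w → (u = i ∧ w = j ∨ u = j ∧ w = i) →
      parallelStates N.source _ ≫ wiring (edgeSystem N.edge) (List.finRange n) _ ≫
        parallelEffects a (List.finRange n) =
      N.source e ≫ parallelEffects (fun k => N.complete hT e k ≫ a k) (List.finRange n) := by
    intro u w huw h
    have hsub : [u, w].Sublist (List.finRange n) := by
      refine List.sublist_of_subperm_of_pairwise (r := (· < ·)) ?_ (by simpa using huw)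
        (List.pairwise_lt_finRange n)
      exact List.subperm_of_subset (by simpa using huw.ne) fun x _ => List.mem_finRange x
    refine hT.circuit_of_pair (List.nodup_finRange n) List.mem_finRange (Finset.nodup_toList _)
      N.source_isTest huw.ne hsub (mem_sources e) (fun e' he' => ?_) a fun k hu hw => ?_
    · have h1 : ¬ (u ∈ e'.1 ∧ w ∈ e'.1) := by
        rintro ⟨h1, h2⟩
        apply he'
        rcases h with ⟨rfl, rfl⟩ | ⟨rfl, rfl⟩
        · exact SourceNode.eq_of_mem huw.ne h1 h2 hi hje
        · exact SourceNode.eq_of_mem huw.ne h1 h2 hje hi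
      by_cases hu : u ∈ e'.1
      · exact Or.inr (if_neg fun hw => h1 ⟨hu, hw⟩)
      · exact Or.inl (if_neg hu)
    · rcases h with ⟨rfl, rfl⟩ | ⟨rfl, rfl⟩
      · exact ha k hu hw
      · exact ha k hw hu
  have key' := hj.lt_or_gt.elim (fun h => key j i h (by simp)) fun h => key i j h (by simp)
  unfold circuit
  -- With `j` discarded too in the auxiliary family, all the star states inserted at `i` are plain
  -- marginals, as in `complete`.
  rw [key', N.star_eq_of_mem hT hj hi hje (Function.update a j (hT.discard _)) a
    fun k hk => (Function.update_of_ne hk _ _).symm, Function.update_of_ne hj.symm]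
  congr 2
  refine parallelEffects_congr fun k _ => ?_
  by_cases hk : k = i
  · subst hk
    rw [Function.update_self, complete, insertFactor_congr (Finset.nodup_toList _) _ fun e' _ =>
      N.starState_discard hT fun j' hj' _ _ => ?_]
    by_cases h : j' = j
    · subst h; simp
    · rw [Function.update_of_ne h, ha j' hj' h]
  · rw [Function.update_of_ne hk]
    by_cases hkj : k = j
    · subst hkj
      simp [starEffect, hi, hje]
    · rw [N.starEffect_discard hT i e fun _ _ => ha k hk hkj, ha k hk hkj,
        hT.comp_discard (N.isDet_complete hT e k)]

/-- Discarding the systems of `i` jointly is discarding them one by one. -/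
lemma star_discard_eq_prod {i : Fin n} {a : ∀ k, N.party k ⟶ 𝟙_ C} (ha : a i = hT.discard _) :
    N.star hT i a = ∏ e, T.prob (N.starState hT i e a ≫ hT.discard _) := by
  unfold star
  rw [ha, ← hT.eq_discard (isDet_parallelEffects (fun e _ => hT.isDet_discard _)),
    prob_parallelStates_comp_parallelEffects, Finset.prod_map_toList]

lemma prob_starState_discard {i : Fin n} {e : SourceNode n 2} {a : ∀ k, N.party k ⟶ 𝟙_ C}
    (h : ∀ k, k ≠ i → i ∈ e.1 → k ∈ e.1 → a k = hT.discard _) :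
    T.prob (N.starState hT i e a ≫ hT.discard _) = 1 := by
  rw [N.starState_discard hT h, hT.eq_id ((hT.isDet_marginal (List.nodup_finRange n)
    (N.source_isTest e) _ _).comp (hT.isDet_discard _)), OperationalTheory.prob_id]

lemma star_discard {i : Fin n} {a : ∀ k, N.party k ⟶ 𝟙_ C} (ha : ∀ k, a k = hT.discard _) :
    N.star hT i a = 1 := by
  rw [N.star_discard_eq_prod hT (ha i)]
  exact Finset.prod_eq_one fun e _ => N.prob_starState_discard hT fun k _ _ _ => ha k

/-- In the star around `i`, the parties other than `i` are independent. -/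
lemma star_independent {i : Fin n} {a : ∀ k, N.party k ⟶ 𝟙_ C} (ha : a i = hT.discard _) :
    N.star hT i a = ∏ j ∈ Finset.univ.erase i,
      N.star hT i (Function.update (fun k => hT.discard (N.party k)) j (a j)) := by
  classical
  rw [N.star_discard_eq_prod hT ha, ← Finset.prod_subset (Finset.subset_univ
    (Finset.univ.filter fun e : SourceNode n 2 => i ∈ e.1))
    fun e _ he => N.prob_starState_discard hT fun k _ h => absurd h (by simpa using he)]
  symm
  -- Sources at `i` correspond to the other parties. In the star with only `j` measured, every
  -- source but `{i, j}` contributes `1`.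
  refine Finset.prod_bij (fun j hj => ⟨{i, j}, Finset.card_pair (Finset.ne_of_mem_erase hj).symm⟩)
    (fun j hj => by simp) (fun j hj j' hj' h => ?_) (fun e he => ?_) fun j hj => ?_
  · have h1 := congrArg Subtype.val h
    have h2 : j ∈ ({i, j'} : Finset (Fin n)) := by
      have h3 : ({i, j} : Finset (Fin n)) = {i, j'} := h1
      rw [← h3]; simp
    simpa [Finset.ne_of_mem_erase hj] using h2
  · have hi : i ∈ e.1 := by simpa using he
    obtain ⟨j, hji, hj⟩ := SourceNode.exists_other i e
    exact ⟨j, by simp [hji], Subtype.ext (SourceNode.eq_pair hji.symm hi hj).symm⟩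
  · have hji := Finset.ne_of_mem_erase hj
    rw [N.star_discard_eq_prod hT (Function.update_of_ne hji.symm _ _),
      Finset.prod_eq_single (⟨{i, j}, Finset.card_pair hji.symm⟩ : SourceNode n 2)
      (fun e _ he => N.prob_starState_discard hT fun k hk h1 h2 => ?_) (by simp)]
    · congr 2
      refine N.starState_congr hT fun k hk _ h2 => ?_
      have : k = j := by simpa [hk] using h2
      subst this
      simp
    · refine Function.update_of_ne ?_ _ _
      rintro rfl
      exact he (SourceNode.eq_of_mem hji.symm h1 h2 (by simp) (by simp))

end GBN

/-! ### Marginals by discarding -/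

section Marginalization

/-- Summing over the coordinates in `U` replaces the effects of these coordinates by `d`. -/
lemma sum_piFinset_eq {ι : Type} [Fintype ι] [DecidableEq ι] {X : ι → Type} [∀ k, Fintype (X k)]
    [∀ k, DecidableEq (X k)]
    {E : ι → Type*} (M : ∀ k, X k → E k) (d : ∀ k, E k) (G : (∀ k, E k) → ℝ)
    (hG : ∀ a k, ∑ x, G (Function.update a k (M k x)) = G (Function.update a k (d k)))
    (U : Finset ι) (z : ∀ k, X k) :
    ∑ y ∈ Fintype.piFinset (fun k => if k ∈ U then Finset.univ else {z k}), G (fun k => M k (y k)) =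
      G (fun k => if k ∈ U then d k else M k (z k)) := by
  induction U using Finset.induction_on generalizing z with
  | empty => simp [Fintype.piFinset_singleton]
  | insert k U hk ih =>
    have h1 : (fun j => if j ∈ insert k U then d j else M j (z j)) =
        Function.update (fun j => if j ∈ U then d j else M j (z j)) k (d k) := by
      funext j
      by_cases hj : j = k
      · subst hj; simp
      · simp [hj]
    -- Fixing `y k = x` leaves the sum for `U` with base point `Function.update z k x`.
    rw [h1, ← hG, ← Finset.sum_fiberwise_of_maps_to (g := fun y => y k) (t := Finset.univ) (by simp)]
    refine Finset.sum_congr rfl fun x _ => ?_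
    have h2 : Function.update (fun j => if j ∈ U then d j else M j (z j)) k (M k x) =
        fun j => if j ∈ U then d j else M j (Function.update z k x j) := by
      funext j
      by_cases hj : j = k
      · subst hj; simp [hk]
      · simp [hj]
    rw [h2, ← ih]
    refine Finset.sum_congr ?_ fun _ _ => rfl
    ext y
    simp only [Finset.mem_filter, Fintype.mem_piFinset]
    constructor
    · rintro ⟨h, rfl⟩ j
      by_cases hj : j = k
      · subst hj; simp [hk]
      · simpa [hj] using h j
    · intro h
      refine ⟨fun j => ?_, by simpa [hk] using h k⟩
      by_cases hj : j = k
      · subst hj; simp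
      · simpa [hj] using h j

end Marginalization

/-! ### Laws and entropies -/

section Law

variable {Ω : Type} [Fintype Ω]

lemma lawOf_nonneg {p : Ω → ℝ} (hp : ∀ ω, 0 ≤ p ω) {Y : Type} (V : Ω → Y) (y : Y) :
    0 ≤ lawOf p V y :=
  Finset.sum_nonneg fun ω _ => hp ω

lemma le_lawOf {p : Ω → ℝ} (hp : ∀ ω, 0 ≤ p ω) {Y : Type} (V : Ω → Y) (ω : Ω) :
    p ω ≤ lawOf p V (V ω) :=
  Finset.single_le_sum (f := p) (fun ω _ => hp ω) (by simp)

lemma sum_lawOf_mul (p : Ω → ℝ) {Y : Type} [Fintype Y] (V : Ω → Y) (f : Y → ℝ) :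
    ∑ y, lawOf p V y * f y = ∑ ω, p ω * f (V ω) := by
  classical
  rw [← Finset.sum_fiberwise_of_maps_to (g := V) (t := Finset.univ) (by simp)]
  refine Finset.sum_congr rfl fun y _ => ?_
  rw [lawOf, Finset.sum_mul]
  refine Finset.sum_congr (by congr) fun ω hω => ?_
  rw [(Finset.mem_filter.1 hω).2]

lemma lawOf_comp (p : Ω → ℝ) {Y Z : Type} [Fintype Y] (V : Ω → Y) (g : Y → Z) (z : Z) :
    lawOf p (fun ω => g (V ω)) z = lawOf (lawOf p V) g z := by
  classical
  have := sum_lawOf_mul p V (fun y => if g y = z then 1 else 0)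
  simp only [mul_ite, mul_one, mul_zero, ← Finset.sum_filter] at this
  unfold lawOf at this ⊢
  convert this.symm using 1

lemma shannonEntropy_eq (p : Ω → ℝ) {Y : Type} [Fintype Y] (V : Ω → Y) :
    shannonEntropy p V = -∑ ω, p ω * Real.logb 2 (lawOf p V (V ω)) := by
  rw [shannonEntropy, sum_lawOf_mul p V fun y => Real.logb 2 (lawOf p V y)]

lemma shannonEntropy_congr {Ω' : Type} [Fintype Ω'] {p : Ω → ℝ} {q : Ω' → ℝ} {Y : Type} [Fintype Y]
    {V : Ω → Y} {W : Ω' → Y} (h : ∀ y, lawOf p V y = lawOf q W y) :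
    shannonEntropy p V = shannonEntropy q W := by
  simp only [shannonEntropy, h]

end Law

/-! ### The entropy inequality -/

/-- If the joint distribution is bounded by the product of the distributions of the variables other
than the `i`-th, then their mutual informations with the `i`-th variable add up to
at most its entropy. -/
theorem sum_mutualInfo_le_of_le_prod {ι : Type} [Fintype ι] [DecidableEq ι] {X : ι → Type}
    [∀ k, Fintype (X k)] (i : ι) (q : (∀ k, X k) → ℝ) (hq : ∀ x, 0 ≤ q x) (hq1 : ∑ x, q x = 1)
    (hle : ∀ x, q x ≤ ∏ j ∈ Finset.univ.erase i, lawOf q (fun x => x j) (x j)) :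
    ∑ j ∈ Finset.univ.erase i, mutualInfo q (fun x => x i) (fun x => x j) ≤
      shannonEntropy q (fun x => x i) := by
  classical
  set L : ∀ j, X j → ℝ := fun j => lawOf q (fun x : ∀ k, X k => x j) with hL
  set P : ∀ j, X i → X j → ℝ := fun j z y => lawOf q (fun x : ∀ k, X k => (x i, x j)) (z, y) with hP
  have hL0 : ∀ j y, 0 ≤ L j y := fun j y => lawOf_nonneg hq _ _
  have hP0 : ∀ j z y, 0 ≤ P j z y := fun j z y => lawOf_nonneg hq _ _
  -- The comparison distribution has conditionally independent variables
  let r : (∀ k, X k) → ℝ := fun x => L i (x i) * ∏ j ∈ Finset.univ.erase i,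
    (P j (x i) (x j) / L i (x i))
  have hmarg : ∀ j z, ∑ y, P j z y = L i z := by
    intro j z
    have h := sum_lawOf_mul q (fun x : ∀ k, X k => (x i, x j)) fun w => if w.1 = z then 1 else 0
    simp only [Fintype.sum_prod_type, mul_ite, mul_one, mul_zero] at h
    rw [Finset.sum_comm] at h
    simp only [Finset.sum_ite_eq', Finset.mem_univ, if_true, ← Finset.sum_filter] at h
    simp only [hP, hL]
    rw [h, lawOf]
  have hr : ∑ x, r x ≤ 1 := by
    -- Summing over the value `z` of `x i` makes each summand a product of functions of single
    -- coordinates, so that the sum over `x` factorizes.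
    have h1 : ∀ x, r x = ∑ z, ∏ j, (if j = i then (if x i = z then L i z else 0) else
        P j z (x j) / L i z) := by
      intro x
      have : ∀ z, ∏ j, (if j = i then (if x i = z then L i z else 0) else P j z (x j) / L i z) =
          if x i = z then L i z * ∏ j ∈ Finset.univ.erase i, (P j z (x j) / L i z) else 0 := by
        intro z
        rw [← Finset.mul_prod_erase _ _ (Finset.mem_univ i), if_pos rfl, Finset.prod_congr rfl
          fun j hj => if_neg (Finset.ne_of_mem_erase hj), ite_mul, zero_mul]
      simp only [this, Finset.sum_ite_eq, Finset.mem_univ, if_true, r]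
    let f : X i → ∀ j, X j → ℝ := fun z j y =>
      if h : j = i then (if h ▸ y = z then L i z else 0) else P j z y / L i z
    have h2 : ∀ z (x : ∀ k, X k), ∏ j, (if j = i then (if x i = z then L i z else 0) else
        P j z (x j) / L i z) = ∏ j, f z j (x j) := by
      intro z x
      refine Finset.prod_congr rfl fun j _ => ?_
      by_cases hj : j = i
      · subst hj; simp [f]
      · simp [f, hj]
    simp only [h1, h2]
    rw [Finset.sum_comm]
    have h3 : ∀ z, ∑ x : ∀ k, X k, ∏ j, f z j (x j) ≤ L i z := by
      intro z
      rw [← Fintype.prod_sum, ← Finset.mul_prod_erase _ _ (Finset.mem_univ i)]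
      have h4 : ∑ y, f z i y = L i z := by simp [f]
      rw [h4]
      refine mul_le_of_le_one_right (hL0 i z) (Finset.prod_le_one (fun j hj => ?_) fun j hj => ?_)
      · refine Finset.sum_nonneg fun y _ => ?_
        simp only [f, dif_neg (Finset.ne_of_mem_erase hj)]
        exact div_nonneg (hP0 _ _ _) (hL0 _ _)
      · simp only [f, dif_neg (Finset.ne_of_mem_erase hj), ← Finset.sum_div, hmarg]
        -- The quotient is `0`, not `1`, when `L i z = 0`; an upper bound suffices.
        exact div_self_le_one _
    refine (Finset.sum_le_sum fun z _ => h3 z).trans_eq ?_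
    have := sum_lawOf_mul q (fun x : ∀ k, X k => x i) fun _ => 1
    simpa [hq1, hL] using this
  have hterm : ∀ x, q x * (Real.log (L i (x i)) + ∑ j ∈ Finset.univ.erase i,
      (Real.log (P j (x i) (x j)) - Real.log (L i (x i)) - Real.log (L j (x j)))) ≤ r x - q x := by
    intro x
    rcases (hq x).eq_or_lt with h0 | h0
    · rw [← h0]
      have : 0 ≤ r x := mul_nonneg (hL0 _ _) (Finset.prod_nonneg fun j _ =>
        div_nonneg (hP0 _ _ _) (hL0 _ _))
      simpa using this
    · have hLi : ∀ j, 0 < L j (x j) := fun j => h0.trans_le (le_lawOf hq (fun x => x j) x)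
      have hPi : ∀ j, 0 < P j (x i) (x j) :=
        fun j => h0.trans_le (le_lawOf hq (fun x : ∀ k, X k => (x i, x j)) x)
      have hprod : 0 < ∏ j ∈ Finset.univ.erase i, L j (x j) := Finset.prod_pos fun j _ => hLi j
      have hr0 : 0 < r x := mul_pos (hLi i) (Finset.prod_pos fun j _ => div_pos (hPi j) (hLi i))
      have hlog : Real.log (r x / ∏ j ∈ Finset.univ.erase i, L j (x j)) =
          Real.log (L i (x i)) + ∑ j ∈ Finset.univ.erase i,
          (Real.log (P j (x i) (x j)) - Real.log (L i (x i)) - Real.log (L j (x j))) := by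
        rw [Real.log_div hr0.ne' hprod.ne', Real.log_mul (hLi i).ne'
          (Finset.prod_pos fun j _ => div_pos (hPi j) (hLi i)).ne',
          Real.log_prod fun j _ => (div_pos (hPi j) (hLi i)).ne', Real.log_prod fun j _ => (hLi j).ne']
        rw [add_sub_assoc, ← Finset.sum_sub_distrib]
        congr 1
        refine Finset.sum_congr rfl fun j _ => ?_
        rw [Real.log_div (hPi j).ne' (hLi i).ne']
      rw [← hlog]
      have h1 := Real.log_le_sub_one_of_pos (div_pos hr0 hprod)
      -- The only use of the bound `hle`.
      have h2 : q x * (r x / ∏ j ∈ Finset.univ.erase i, L j (x j)) ≤ r x := by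
        rw [mul_div_assoc', div_le_iff₀ hprod, mul_comm]
        exact mul_le_mul_of_nonneg_left (hle x) hr0.le
      nlinarith [mul_le_mul_of_nonneg_left h1 h0.le]
  have hsum := Finset.sum_le_sum fun x (_ : x ∈ Finset.univ) => hterm x
  rw [Finset.sum_sub_distrib, hq1] at hsum
  have hsum' := hsum.trans (sub_nonpos.2 hr)
  have hlog2 : 0 < Real.log 2 := Real.log_pos (by norm_num)
  have hkey : (∑ j ∈ Finset.univ.erase i, mutualInfo q (fun x => x i) (fun x => x j) -
      shannonEntropy q (fun x => x i)) * Real.log 2 =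
      ∑ x, q x * (Real.log (L i (x i)) + ∑ j ∈ Finset.univ.erase i,
      (Real.log (P j (x i) (x j)) - Real.log (L i (x i)) - Real.log (L j (x j)))) := by
    have e : ∀ x : ℝ, Real.logb 2 x = Real.log x / Real.log 2 := fun x => rfl
    have hH : ∀ {Y : Type} [Fintype Y] (V : (∀ k, X k) → Y), shannonEntropy q V * Real.log 2 =
        -∑ x, q x * Real.log (lawOf q V (V x)) := by
      intro Y _ V
      rw [shannonEntropy_eq, neg_mul, Finset.sum_mul]
      congr 1
      refine Finset.sum_congr rfl fun x _ => ?_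
      rw [e]
      field_simp
    simp only [mutualInfo, sub_mul, Finset.sum_mul, add_mul, hH, mul_add, mul_sub, Finset.mul_sum,
      Finset.sum_add_distrib, Finset.sum_sub_distrib]
    rw [Finset.sum_comm (s := Finset.univ) (t := Finset.univ.erase i),
      Finset.sum_comm (s := Finset.univ) (t := Finset.univ.erase i),
      Finset.sum_comm (s := Finset.univ) (t := Finset.univ.erase i)]
    simp only [Finset.sum_neg_distrib, hL, hP]
    ring
  rw [← hkey] at hsum'
  have := nonpos_of_mul_nonpos_left hsum' hlog2
  linarith

/-- By `hV` the fibre of `V` through `z` leaves the coordinates in `U` free and fixes the others. -/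
lemma lawOf_eq_of_forall_notMem_iff {ι : Type} [Fintype ι] [DecidableEq ι] {X : ι → Type}
    [∀ k, Fintype (X k)] {E : ι → Type*} (M : ∀ k, X k → E k) (d : ∀ k, E k)
    (G : (∀ k, E k) → ℝ)
    (hG : ∀ a k, ∑ x, G (Function.update a k (M k x)) = G (Function.update a k (d k)))
    (U : Finset ι) (z : ∀ k, X k) {Y : Type} (V : (∀ k, X k) → Y)
    (hV : ∀ y, V y = V z ↔ ∀ k, k ∉ U → y k = z k) :
    lawOf (fun x => G fun k => M k (x k)) V (V z) =
      G (fun k => if k ∈ U then d k else M k (z k)) := by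
  classical
  rw [← sum_piFinset_eq M d G hG, lawOf]
  refine Finset.sum_congr ?_ fun _ _ => rfl
  ext y
  simp only [Finset.mem_filter, Finset.mem_univ, true_and, hV, Fintype.mem_piFinset]
  refine forall_congr' fun k => ?_
  split_ifs with h <;> simp [h]

/-! ### Network and star compared -/

namespace GBN

variable {C : Type u} [Category.{v} C] [MonoidalCategory C] [SymmetricCategory C]
  {T : OperationalTheory C} (hT : T.IsCausal) {n : ℕ} {X : Fin n → Type} [∀ i, Fintype (X i)]
  (N : GBN T n 2 X)

/-- The joint distribution of the outcomes in the star around `i`. -/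
noncomputable def starDist (i : Fin n) (x : ∀ k, X k) : ℝ := N.star hT i fun k => N.meas k (x k)

lemma circuit_discard : N.circuit (fun k => hT.discard (N.party k)) = 1 := by
  unfold circuit
  rw [hT.eq_id ((isDet_parallelStates N.source_isTest _).comp ((isDet_wiring _ _ _).comp
    (isDet_parallelEffects fun k _ => hT.isDet_discard _))), OperationalTheory.prob_id]

include hT in
lemma sum_dist [Nonempty (∀ k, X k)] : ∑ x, N.dist x = 1 := by
  classical
  have h := sum_piFinset_eq N.meas (fun k => hT.discard (N.party k)) N.circuit
    (fun a k => N.sum_circuit hT a k _ (N.meas_isTest k)) Finset.univ (Classical.arbitrary _)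
  simp only [Finset.mem_univ, if_true, Fintype.piFinset_univ] at h
  exact h.trans (N.circuit_discard hT)

lemma sum_starDist [Nonempty (∀ k, X k)] (i : Fin n) : ∑ x, N.starDist hT i x = 1 := by
  classical
  have h := sum_piFinset_eq N.meas (fun k => hT.discard (N.party k)) (N.star hT i)
    (fun a k => N.sum_star hT i a k _ (N.meas_isTest k)) Finset.univ (Classical.arbitrary _)
  simp only [Finset.mem_univ, if_true, Fintype.piFinset_univ] at h
  exact h.trans (N.star_discard hT fun _ => rfl)

lemma lawOf_dist_pair [Nonempty (∀ k, X k)] {i j : Fin n} (hj : j ≠ i) (y : X i × X j) :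
    lawOf N.dist (fun x : ∀ k, X k => (x i, x j)) y =
      lawOf (N.starDist hT i) (fun x : ∀ k, X k => (x i, x j)) y := by
  obtain ⟨z, rfl⟩ : ∃ z : ∀ k, X k, (z i, z j) = y :=
    ⟨Function.update (Function.update (Classical.arbitrary _) i y.1) j y.2, by simp [hj.symm]⟩
  have hV : ∀ x : ∀ k, X k, (x i, x j) = (z i, z j) ↔
      ∀ k, k ∉ Finset.univ.filter (fun k => k ≠ i ∧ k ≠ j) → x k = z k := by
    intro x
    simp only [Prod.mk.injEq, Finset.mem_filter, Finset.mem_univ, true_and, not_and_or, not_not]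
    constructor
    · rintro ⟨h1, h2⟩ k (rfl | rfl)
      exacts [h1, h2]
    · exact fun h => ⟨h i (Or.inl rfl), h j (Or.inr rfl)⟩
  have h1 := lawOf_eq_of_forall_notMem_iff N.meas (fun k => hT.discard (N.party k)) N.circuit
    (fun a k => N.sum_circuit hT a k _ (N.meas_isTest k)) _ z _ hV
  have h2 := lawOf_eq_of_forall_notMem_iff N.meas (fun k => hT.discard (N.party k)) (N.star hT i)
    (fun a k => N.sum_star hT i a k _ (N.meas_isTest k)) _ z _ hV
  refine h1.trans (Eq.trans ?_ h2.symm)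
  exact (N.star_eq_circuit hT hj _ fun k hk hkj => by simp [hk, hkj]).symm

lemma lawOf_starDist (i j : Fin n) (z : ∀ k, X k) :
    lawOf (N.starDist hT i) (fun x : ∀ k, X k => x j) (z j) =
      N.star hT i (Function.update (fun k => hT.discard (N.party k)) j (N.meas j (z j))) := by
  refine (lawOf_eq_of_forall_notMem_iff N.meas (fun k => hT.discard (N.party k)) (N.star hT i)
    (fun a k => N.sum_star hT i a k _ (N.meas_isTest k)) (Finset.univ.erase j) z _ ?_).trans ?_
  · simp
  · congr 1
    funext k
    by_cases hk : k = j
    · subst hk; simp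
    · simp [hk]

/-- Forgetting the outcome of `i` can only raise the probability, and the remaining outcomes are
independent. -/
lemma starDist_le_prod (i : Fin n) (x : ∀ k, X k) :
    N.starDist hT i x ≤ ∏ j ∈ Finset.univ.erase i,
      lawOf (N.starDist hT i) (fun x : ∀ k, X k => x j) (x j) := by
  classical
  have h := sum_piFinset_eq N.meas (fun k => hT.discard (N.party k)) (N.star hT i)
    (fun a k => N.sum_star hT i a k _ (N.meas_isTest k)) {i} x
  have hle : N.starDist hT i x ≤ N.star hT i
      (fun k => if k ∈ ({i} : Finset (Fin n)) then hT.discard _ else N.meas k (x k)) := by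
    rw [← h]
    refine Finset.single_le_sum (f := fun y : ∀ k, X k => N.star hT i fun k => N.meas k (y k))
      (fun y _ => T.prob_nonneg _) (Fintype.mem_piFinset.2 fun k => ?_)
    split_ifs <;> simp
  refine hle.trans_eq ?_
  rw [N.star_independent hT (by simp)]
  refine Finset.prod_congr rfl fun j hj => ?_
  rw [N.lawOf_starDist hT, if_neg (by simpa using Finset.ne_of_mem_erase hj)]

end GBN

theorem mainTheorem4 {C : Type u} [Category.{v} C] [MonoidalCategory C] [SymmetricCategory C]
    (T : OperationalTheory C) (hT : T.IsCausal) (n : ℕ) (X : Fin n → Type)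
    [∀ i, Fintype (X i)] (N : GBN T n 2 X) (i : Fin n) :
    ∑ j ∈ Finset.univ.erase i,
        mutualInfo N.dist (fun x : ∀ k, X k => x i) (fun x : ∀ k, X k => x j) ≤
      shannonEntropy N.dist (fun x : ∀ k, X k => x i) := by
  -- Without joint outcomes all laws, hence all entropies, vanish.
  rcases isEmpty_or_nonempty (∀ k, X k) with hX | hX
  · simp [mutualInfo, shannonEntropy, lawOf]
  -- The law of `V_i` in the star is read off from a pair law, which needs a second party. If there
  -- is none, the product bound is empty and `N.dist` itself satisfies it.
  by_cases hi : ∃ j, j ≠ i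
  · obtain ⟨j₀, hj₀⟩ := hi
    have hV : ∀ y, lawOf N.dist (fun x : ∀ k, X k => x i) y =
        lawOf (N.starDist hT i) (fun x : ∀ k, X k => x i) y := by
      intro y
      have h := fun p : (∀ k, X k) → ℝ => lawOf_comp p (fun x => (x i, x j₀)) Prod.fst y
      simp only at h
      rw [h, h, funext (N.lawOf_dist_pair hT hj₀)]
    rw [shannonEntropy_congr hV]
    refine le_of_eq_of_le (Finset.sum_congr rfl fun j hj => ?_) (sum_mutualInfo_le_of_le_prod i
      (N.starDist hT i) (fun x => T.prob_nonneg _) (N.sum_starDist hT i) (N.starDist_le_prod hT i))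
    have hji := Finset.ne_of_mem_erase hj
    have hW : ∀ y, lawOf N.dist (fun x : ∀ k, X k => x j) y =
        lawOf (N.starDist hT i) (fun x : ∀ k, X k => x j) y := by
      intro y
      have h := fun p : (∀ k, X k) → ℝ => lawOf_comp p (fun x => (x i, x j)) Prod.snd y
      simp only at h
      rw [h, h, funext (N.lawOf_dist_pair hT hji)]
    rw [mutualInfo, mutualInfo, shannonEntropy_congr hV, shannonEntropy_congr hW,
      shannonEntropy_congr (N.lawOf_dist_pair hT hji)]
  · refine sum_mutualInfo_le_of_le_prod i N.dist (fun x => T.prob_nonneg _) (N.sum_dist hT)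
      fun x => ?_
    rw [Finset.prod_eq_one fun j hj => absurd ⟨j, Finset.ne_of_mem_erase hj⟩ hi, ← N.sum_dist hT]
    exact Finset.single_le_sum (f := N.dist) (fun x _ => T.prob_nonneg _) (Finset.mem_univ x)
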